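/- **Definitions.** For a finite graph $G=(V,E)$ with edge weights $w$, a hierarchical clustering tree of $G$ is a finite rooted tree $\mathcal T$ whose leaves are in bijection with $V$. Its (Dasgupta) cost is $$\mathsf C_G(\mathcal T)=\sum_{e=\{u,v\}\in E} w(e)\cdot\bigl|\text{leaf-nodes}(\mathcal T[u\vee v])\bigr|,$$ where $\mathcal T[u\vee v]$ is the subtree of $\mathcal T$ rooted at the lowest common ancestor of $u$ and $v$. The optimal HC value $\mathrm{opt}(G)$ is the minimum of $\mathsf C_G(\mathcal T)$ over all hierarchical clustering trees $\mathcal T$ of $G$. A (randomized, single-pass) streaming algorithm on $n$-vertex graphs with space $s$ reads the edges of the input graph one by one, each exactly once, in an arbitrary order. Between two edges it keeps only $s$ bits of memory. At the end it outputs a real number computed from its memory. Its computation time is unrestricted, it may be different for every $n$, and its updates and its output may freely use a random seed (drawn independently of the input). The updates may also use the number of edges read so far. Such an algorithm *estimates the optimal HC value with approximation ratio $\alpha$ and probability $p$* if for every simple unweighted graph $G$ on $n$ vertices (all $w(e)=1$) and every order of its edges, its output $X$ satisfies $$\Pr\bigl[\mathrm{opt}(G)\le X\le \alpha\cdot \mathrm{opt}(G)\bigr]\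 \ge\ p .$$ **Theorem 5.1.** Let $\delta>0$ and $p>1/2$ be constants, and for every $n$ let $A_n$ be a streaming algorithm on $n$-vertex graphs with space $s(n)$, where $s(n)=O((\log n)^c)$ for some constant $c$. Then, for all sufficiently large $n$, $A_n$ does not estimate the optimal HC value with approximation ratio $n^{1/2-\delta}$ and probability $p$. -/

import Mathlib

noncomputable section

namespace HC

/-- Finite rooted trees whose leaves are labelled by elements of `V`; an internal node may have
any positive number of children. -/
inductive ClusterTree (V : Type) : Type
  | leaf (v : V) : ClusterTree V
  | node (k : ℕ) (children : Fin (k + 1) → ClusterTree V) : ClusterTree V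

namespace ClusterTree

variable {V : Type}

/-- The labels of the leaves of a tree, with multiplicity. -/
def leaves : ClusterTree V → Multiset V
  | leaf v => {v}
  | node _ children => ∑ i, (children i).leaves

/-- A hierarchical clustering tree on the vertex set `V`: every vertex labels exactly one leaf. -/
def IsHCTree [Fintype V] (T : ClusterTree V) : Prop :=
  T.leaves = (Finset.univ : Finset V).val

open Classical in
/-- The subtree `T[u ∨ v]` of `T` rooted at the lowest common ancestor of the two endpoints of
`e = s(u, v)`: descend as long as some child still has both endpoints among its leaves. -/
def lca : ClusterTree V → Sym2 V → ClusterTree V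
  | leaf v, _ => leaf v
  | node k children, e =>
    if h : ∃ i, ∀ v ∈ e, v ∈ (children i).leaves then (children h.choose).lca e
    else node k children

/-- Dasgupta's cost of the tree `T` for the graph `G` with edge weights `w`. -/
def cost [Fintype V] (G : SimpleGraph V) (w : Sym2 V → ℝ) (T : ClusterTree V) : ℝ :=
  ∑ᶠ e ∈ G.edgeSet, w e * ((T.lca e).leaves.card : ℝ)

end ClusterTree

/-- The cost of an optimal hierarchical clustering tree of the weighted graph `(G, w)`. -/
def opt {V : Type} [Fintype V] (G : SimpleGraph V) (w : Sym2 V → ℝ) : ℝ :=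
  sInf {c : ℝ | ∃ T : ClusterTree V, T.IsHCTree ∧ c = T.cost G w}

/-- A list of edges is a stream of the graph `G` if it contains every edge of `G` exactly once
(in an arbitrary order) and nothing else. -/
def IsStreamOf {n : ℕ} (σ : List (Sym2 (Fin n))) (G : SimpleGraph (Fin n)) : Prop :=
  σ.Nodup ∧ ∀ e, e ∈ σ ↔ e ∈ G.edgeSet

/-- A randomized single-pass streaming algorithm for graphs on `n` vertices, whose memory between
two consecutive edges of the stream consists of `space` bits. Neither computation time nor
access to the random seed `ω`, whose distribution is `μ`, is restricted. The updates may depend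
on the number of edges that have been read so far, so that fresh randomness can be used at
every step. -/
structure StreamingAlgorithm (n : ℕ) where
  space : ℕ
  Ω : Type
  [measurableSpace : MeasurableSpace Ω]
  μ : MeasureTheory.Measure Ω
  [isProbabilityMeasure : MeasureTheory.IsProbabilityMeasure μ]
  init : Ω → (Fin space → Bool)
  update : Ω → ℕ → Sym2 (Fin n) → (Fin space → Bool) → (Fin space → Bool)
  output : Ω → (Fin space → Bool) → ℝ
  measurable_init : Measurable init
  measurable_update : ∀ i e s, Measurable fun ω => update ω i e s
  measurable_output : ∀ s, Measurable fun ω => output ω s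

namespace StreamingAlgorithm

variable {n : ℕ}

attribute [instance] measurableSpace isProbabilityMeasure

/-- The output of the algorithm on the stream `σ` and the random seed `ω`. -/
def run (A : StreamingAlgorithm n) (ω : A.Ω) (σ : List (Sym2 (Fin n))) : ℝ :=
  A.output ω (σ.zipIdx.foldl (fun s p => A.update ω p.2 p.1 s) (A.init ω))

/-- On every simple unweighted `n`-vertex graph (all edge weights are `1`) and every order of its
edges, the algorithm outputs, with probability at least `p`, an estimate of the optimal
hierarchical clustering value with approximation ratio `α`. -/
def Estimates (A : StreamingAlgorithm n) (α p : ℝ) : Prop :=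
  ∀ (G : SimpleGraph (Fin n)) (σ : List (Sym2 (Fin n))), IsStreamOf σ G →
    p ≤ A.μ.real {ω | opt G (fun _ => 1) ≤ A.run ω σ ∧ A.run ω σ ≤ α * opt G (fun _ => 1)}

end StreamingAlgorithm

end HC

end

/-! The hard instances are lifts of a random bipartite multigraph with `N` vertices on each side and
`m` edges. Every edge carries a label in `(ZMod 2) ^ k`, which says how the `2 ^ k` sheets are
joined above it; lifted edges are subdivided, so the graph stays simple when base edges repeat.

If the labels are sums `θ.1 u + θ.2 v` of vertex potentials, the lift falls into `2 ^ k` pieces of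
at most `2 * N + m` vertices, and clustering each piece separately is cheap
(`opt_liftGraph_induced_le`). If the labels are uniform and independent, the lift typically expands:
any colouring with classes of size at most a small multiple of `N * 2 ^ k` has at least `N * 2 ^ k`
bichromatic edges. Cutting a tree at its maximal small subtrees (`exists_coloring_of_tree`) turns
this into a cost of order `N ^ 2 * 4 ^ k` (`le_opt_liftGraph`). With `m` about `N * log n`, the two
values differ by a factor `2 ^ k` up to logarithms. Taking `N` slightly above and `2 ^ k` slightly
below the square root of `n` gives the ratio.

Expansion is proved with a lazy walk that reads the edges in order and tosses a coin before crossing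
each. Two walks from the same start rarely meet at the end, so by Cauchy–Schwarz they seldom end in
the small colour class of the start; but each change of colour must be paid for by a bichromatic
edge (`le_crossings`).

For a fixed seed, the algorithm is a process with `s` bits of state that reads one labelled base
edge at a time. By hypercontractive moment bounds (`level_two`), the state carries chi-square
information `ε` of order `2 ^ k * s ^ 2 / N ^ 2` about the induced label of a random pair. Adding up
total variation distances would give `m * √ε`, which is too large. Instead, `abs_process_sub_le`
charges each step to the variance of the conditional success probability. The total variance is
bounded because that probability lies in `[0, 1]`, so smallness of `m * ε` suffices. An algorithm
that estimates well would separate the two distributions by a threshold (`not_estimates`). -/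

noncomputable section

namespace HC

open Finset
open scoped BigOperators

/-! ### Cluster trees and vertex colourings -/

namespace ClusterTree

variable {V : Type}

/-- The tree whose root has the trees of a nonempty list as children. -/
def ofList (L : List (ClusterTree V)) (hL : L ≠ []) : ClusterTree V :=
  node (L.length - 1) fun i => L.get (i.cast (Nat.sub_add_cancel (List.length_pos_iff.2 hL)))

lemma leaves_ofList (L : List (ClusterTree V)) (hL : L ≠ []) :
    (ofList L hL).leaves = (L.map leaves).sum := by
  have h : L.length - 1 + 1 = L.length := Nat.sub_add_cancel (List.length_pos_iff.2 hL)
  rw [ofList, leaves, ← Fin.sum_univ_fun_getElem]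
  exact Fintype.sum_equiv (finCongr h) _ _ fun i => by simp

/-- The tree of depth one with leaf set `s`. -/
def star (s : Finset V) (hs : s.Nonempty) : ClusterTree V :=
  ofList (s.toList.map leaf) (by simpa using hs.ne_empty)

lemma leaves_star (s : Finset V) (hs : s.Nonempty) : (star s hs).leaves = s.val := by
  rw [star, leaves_ofList, List.map_map]
  have : (leaves ∘ leaf : V → Multiset V) = fun v => {v} := by
    funext v; simp [leaves]
  rw [this]
  conv_rhs => rw [← Finset.coe_toList s]
  induction s.toList with
  | nil => rfl
  | cons a l ih => rw [List.map_cons, List.sum_cons, ih]; rfl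

/-- The tree of depth two whose second level consists of the colour classes of `f`. -/
lemma exists_tree_of_coloring [Fintype V] [Nonempty V] {C : Type} [DecidableEq C] (f : V → C) :
    ∃ T : ClusterTree V, T.IsHCTree ∧ ∀ u v, f u = f v →
      (T.lca s(u, v)).leaves.card ≤ #{w | f w = f u} := by
  classical
  have hne : ∀ c ∈ univ.image f, ({w | f w = c} : Finset V).Nonempty := by
    intro c hc
    obtain ⟨v, -, rfl⟩ := mem_image.1 hc
    exact ⟨v, by simp⟩
  let L : List (ClusterTree V) :=
    (univ.image f).toList.attach.map fun c => star _ (hne c.1 (by simpa using c.2))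
  have hL : L ≠ [] := by
    obtain ⟨v⟩ := ‹Nonempty V›
    have : f v ∈ (univ.image f).toList := by simp
    intro h
    have h' := List.map_eq_nil_iff.1 h
    rw [List.attach_eq_nil_iff] at h'
    rw [h'] at this
    simp at this
  have hleaves : (ofList L hL).leaves = (univ : Finset V).val := by
    rw [leaves_ofList, List.map_map]
    have h1 : ((univ.image f).toList.attach.map
        (leaves ∘ fun c => star _ (hne c.1 (by simpa using c.2)))) =
        (univ.image f).toList.map fun c => ({w | f w = c} : Finset V).val := by
      conv_rhs => rw [← List.attach_map_val (l := (univ.image f).toList)]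
      refine List.map_congr_left fun c _ => ?_
      simp [leaves_star]
    rw [h1]
    have h2 : ((univ.image f).toList.map fun c => ({w | f w = c} : Finset V).val).sum =
        ∑ c ∈ univ.image f, ({w | f w = c} : Finset V).val := by
      rw [Finset.sum_map_toList]
    rw [h2]
    ext v
    rw [Multiset.count_sum', Finset.sum_eq_single (f v)]
    · rw [Multiset.count_eq_one_of_mem (Finset.nodup _) (by simp),
        Multiset.count_eq_one_of_mem (Finset.nodup _) (by simp)]
    · intro c _ hc
      rw [Multiset.count_eq_zero_of_notMem]
      simpa using fun h => hc h.symm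
    · simp
  refine ⟨ofList L hL, hleaves, fun u v huv => ?_⟩
  have hchild : ∀ i : Fin L.length, ∃ c, ∃ h, L.get i = star {w | f w = c} h := by
    intro i
    have := List.get_mem L i
    obtain ⟨c, -, hc⟩ := List.mem_map.1 this
    exact ⟨c.1, _, hc.symm⟩
  have hlca : ∀ (T : ClusterTree V) e, (T.lca e).leaves.card ≤ T.leaves.card := by
    intro T e
    induction T with
    | leaf v => simp [lca]
    | node k ch ih =>
      rw [lca]
      split_ifs with h
      · refine (ih _).trans ?_
        rw [leaves]
        exact Multiset.card_le_card (Finset.single_le_sum (f := fun i => (ch i).leaves)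
          (fun _ _ => Multiset.zero_le _) (mem_univ _))
      · exact le_rfl
  unfold ofList lca
  split_ifs with h
  -- Whichever child is chosen, it is the star of one colour class and contains `u`, so that class
  -- is the one of `f u`.
  · refine (hlca _ _).trans ?_
    have hs := h.choose_spec
    generalize h.choose = i at hs ⊢
    obtain ⟨c, hc, hi⟩ := hchild (i.cast (Nat.sub_add_cancel (List.length_pos_iff.2 hL)))
    beta_reduce at hs ⊢
    rw [hi] at hs ⊢
    rw [leaves_star] at hs ⊢
    have hu := hs u (by simp)
    simp only [mem_val, mem_filter, mem_univ, true_and] at hu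
    rw [hu]; rfl
  · exfalso
    apply h
    have hm : f u ∈ (univ.image f).toList := by simp
    have : star {w | f w = f u} (hne (f u) (by simp)) ∈ L :=
      List.mem_map.2 ⟨⟨f u, hm⟩, List.mem_attach _ _, rfl⟩
    obtain ⟨i, hi⟩ := List.get_of_mem this
    refine ⟨i.cast (Nat.sub_add_cancel (List.length_pos_iff.2 hL)).symm, fun w hw => ?_⟩
    have : w = u ∨ w = v := by simpa using hw
    simp only [Fin.cast_cast, Fin.cast_eq_self]
    rw [hi, leaves_star]
    rcases this with rfl | rfl <;> simp [huv]

/-- Cutting a tree at its maximal subtrees with at most `k` leaves. -/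
lemma exists_coloring_of_tree (k : ℕ) (hk : 1 ≤ k) (T : ClusterTree V) (hT : T.leaves.Nodup) :
    ∃ f : V → List ℕ, (∀ (s : Finset V) (c : List ℕ), (∀ v ∈ s, v ∈ T.leaves ∧ f v = c) → #s ≤ k) ∧
      ∀ u ∈ T.leaves, ∀ v ∈ T.leaves, f u ≠ f v → k < (T.lca s(u, v)).leaves.card := by
  classical
  induction T with
  | leaf v =>
    refine ⟨fun _ => [], fun s c hs => ?_, fun u _ v _ h => absurd rfl h⟩
    refine le_trans (Finset.card_le_one.2 fun a ha b hb => ?_) hk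
    have h1 := (hs a ha).1
    have h2 := (hs b hb).1
    simp only [leaves, Multiset.mem_singleton] at h1 h2
    rw [h1, h2]
  | node d ch ih =>
    -- A subtree that is already small is one piece and receives a single colour.
    by_cases hle : (node d ch).leaves.card ≤ k
    · refine ⟨fun _ => [], fun s c hs => le_trans ?_ hle, fun u _ v _ h => absurd rfl h⟩
      rw [← Finset.card_val]
      exact Multiset.card_le_card ((Multiset.le_iff_subset s.nodup).2 fun v hv => (hs v hv).1)
    · have hsub : ∀ i, (ch i).leaves ≤ (node d ch).leaves := fun i => by
        rw [leaves]
        exact Finset.single_le_sum (f := fun i => (ch i).leaves)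
          (fun _ _ => Multiset.zero_le _) (mem_univ _)
      have hnd : ∀ i, (ch i).leaves.Nodup := fun i => Multiset.nodup_of_le (hsub i) hT
      choose f hf1 hf2 using fun i => ih i (hnd i)
      have hmem : ∀ v ∈ (node d ch).leaves, ∃ i, v ∈ (ch i).leaves := by
        intro v hv
        rw [leaves, Multiset.mem_sum] at hv
        obtain ⟨i, -, hi⟩ := hv
        exact ⟨i, hi⟩
      have huniq : ∀ v i j, v ∈ (ch i).leaves → v ∈ (ch j).leaves → i = j := by
        intro v i j hi hj
        by_contra hij
        have h2 : (ch i).leaves + (ch j).leaves ≤ (node d ch).leaves := by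
          rw [leaves, ← Finset.sum_pair (f := fun i => (ch i).leaves) hij]
          exact Finset.sum_le_sum_of_subset (subset_univ _)
        have h3 := Multiset.nodup_of_le h2 hT
        rw [Multiset.nodup_add] at h3
        exact (Multiset.disjoint_left.1 h3.2.2) hi hj
      -- The colour of a vertex is the path of child indices leading to its maximal small subtree.
      -- The value `[]` is a default for labels that do not occur in this tree.
      let g : V → List ℕ := fun v =>
        if h : ∃ i, v ∈ (ch i).leaves then (h.choose : ℕ) :: f h.choose v else []
      have hg : ∀ v i, v ∈ (ch i).leaves → g v = (i : ℕ) :: f i v := by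
        intro v i hi
        have h : ∃ i, v ∈ (ch i).leaves := ⟨i, hi⟩
        have e : h.choose = i := huniq v _ _ h.choose_spec hi
        simp only [g, dif_pos h, e]
      refine ⟨g, fun s c hs => ?_, fun u hu v hv huv => ?_⟩
      · rcases s.eq_empty_or_nonempty with rfl | ⟨a, ha⟩
        · simp
        obtain ⟨i, hi⟩ := hmem a (hs a ha).1
        have hc := (hs a ha).2
        rw [hg a i hi] at hc
        refine hf1 i s (f i a) fun v hv => ?_
        obtain ⟨j, hj⟩ := hmem v (hs v hv).1
        have hcv := (hs v hv).2
        rw [hg v j hj, ← hc] at hcv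
        simp only [List.cons.injEq] at hcv
        have : j = i := Fin.ext hcv.1
        subst this
        exact ⟨hj, hcv.2⟩
      · rw [lca]
        split_ifs with h
        · have hs := h.choose_spec
          generalize h.choose = i at hs ⊢
          have hui := hs u (by simp)
          have hvi := hs v (by simp)
          refine hf2 i u hui v hvi fun e => huv ?_
          rw [hg u i hui, hg v i hvi, e]
        -- No child contains both vertices, so the lowest common ancestor is this node, which is too
        -- large to be a piece.
        · exact not_le.1 hle

end ClusterTree

/-! ### Bounds on the optimal value from colourings -/

open ClusterTree

lemma cost_nonneg {V : Type} [Fintype V] (G : SimpleGraph V) (T : ClusterTree V) :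
    0 ≤ T.cost G (fun _ => 1) := by
  unfold ClusterTree.cost
  refine finsum_nonneg fun e => finsum_nonneg fun _ => by positivity

lemma opt_nonneg {V : Type} [Fintype V] (G : SimpleGraph V) : 0 ≤ opt G (fun _ => 1) :=
  Real.sInf_nonneg (by rintro c ⟨T, -, rfl⟩; exact cost_nonneg G T)

lemma cost_eq_sum {V : Type} [Fintype V] (G : SimpleGraph V) (T : ClusterTree V)
    (E : Finset (Sym2 V)) (hE : ∀ e, e ∈ E ↔ e ∈ G.edgeSet) :
    T.cost G (fun _ => 1) = ∑ e ∈ E, ((T.lca e).leaves.card : ℝ) := by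
  unfold ClusterTree.cost
  have : G.edgeSet = (E : Set (Sym2 V)) := by ext e; simp [hE]
  rw [this, finsum_mem_coe_finset]
  simp

/-- If no edge joins different colour classes and every class that contains an edge has at most
`K` vertices, then the optimal value is at most `K` times the number of edges. -/
lemma opt_le_of_coloring {V : Type} [Fintype V] [Nonempty V] (G : SimpleGraph V)
    (E : Finset (Sym2 V)) (hE : ∀ e, e ∈ E ↔ e ∈ G.edgeSet) {C : Type} [DecidableEq C] (f : V → C)
    (K : ℕ) (h : ∀ u v, s(u, v) ∈ E → f u = f v ∧ #{w | f w = f u} ≤ K) :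
    opt G (fun _ => 1) ≤ #E * K := by
  obtain ⟨T, hT, hc⟩ := exists_tree_of_coloring f
  have hb : BddBelow {c : ℝ | ∃ T : ClusterTree V, T.IsHCTree ∧ c = T.cost G (fun _ => 1)} :=
    ⟨0, by rintro c ⟨T, -, rfl⟩; exact cost_nonneg G T⟩
  refine (csInf_le hb ⟨T, hT, rfl⟩).trans ?_
  · rw [cost_eq_sum G T E hE, ← nsmul_eq_mul]
    refine Finset.sum_le_card_nsmul _ _ _ fun e he => ?_
    induction e using Sym2.ind with
    | _ u v => exact_mod_cast (hc u v (h u v he).1).trans (h u v he).2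

/-- If every colouring with colour classes of size at most `k` has at least `M` bichromatic
edges, then the optimal value is at least `k * M`. -/
lemma le_opt_of_coloring {V : Type} [Fintype V] [Nonempty V] (G : SimpleGraph V)
    (E : Finset (Sym2 V)) (hE : ∀ e, e ∈ E ↔ e ∈ G.edgeSet) (k : ℕ) (hk : 1 ≤ k) (M : ℝ)
    (h : ∀ f : V → List ℕ, (∀ c, #{v | f v = c} ≤ k) → ∃ B ⊆ E,
      (∀ u v, s(u, v) ∈ B → f u ≠ f v) ∧ M ≤ #B) :
    k * M ≤ opt G (fun _ => 1) := by
  have hne : {c : ℝ | ∃ T : ClusterTree V, T.IsHCTree ∧ c = T.cost G (fun _ => 1)}.Nonempty := by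
    obtain ⟨T, hT, -⟩ := exists_tree_of_coloring (fun _ : V => ())
    exact ⟨_, T, hT, rfl⟩
  refine le_csInf hne ?_
  rintro _ ⟨T, hT, rfl⟩
  unfold IsHCTree at hT
  obtain ⟨f, hf1, hf2⟩ := exists_coloring_of_tree k hk T (by rw [hT]; exact Finset.nodup _)
  obtain ⟨B, hBE, hB, hM⟩ := h f fun c => hf1 _ c fun v hv => ⟨by simp [hT], by simpa using hv⟩
  rw [cost_eq_sum G T E hE]
  calc k * M ≤ ∑ e ∈ B, (k : ℝ) := by
        rw [Finset.sum_const, nsmul_eq_mul, mul_comm]; gcongr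
    _ ≤ ∑ e ∈ B, ((T.lca e).leaves.card : ℝ) := by
        refine Finset.sum_le_sum fun e he => ?_
        induction e using Sym2.ind with
        | _ u v => exact_mod_cast (hf2 u (by simp [hT]) v (by simp [hT]) (hB u v he)).le
    _ ≤ _ := Finset.sum_le_sum_of_subset_of_nonneg hBE fun _ _ _ => by positivity

/-! ### Moment inequalities and the level-two inequality -/

section Khintchine

lemma expect_pi_prod {ι Γ : Type} [Fintype ι] [DecidableEq ι] [Fintype Γ] (f : ι → Γ → ℝ) :
    𝔼 x : ι → Γ, ∏ u, f u (x u) = ∏ u, 𝔼 g, f u g := by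
  simp only [Fintype.expect_eq_sum_div_card]
  rw [Finset.prod_div_distrib, Finset.prod_univ_sum, Fintype.piFinset_univ]
  simp [Fintype.card_pi]

variable {ι κ Γ Θ : Type} [Fintype ι] [DecidableEq ι] [Fintype κ] [DecidableEq κ]
  [Fintype Γ] [Nonempty Γ] [Fintype Θ]

/-- Signs are sub-Gaussian: since `ε = ±1` has mean zero, each independent factor has mean `cosh (b
u)`, which is at most `exp (b u ^ 2 / 2)`. -/
lemma expect_exp_rademacher (ε : Γ → ℝ) (h1 : ∀ g, ε g ^ 2 = 1) (h0 : 𝔼 g, ε g = 0)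
    (b : ι → ℝ) :
    𝔼 x : ι → Γ, Real.exp (∑ u, b u * ε (x u)) ≤ Real.exp ((∑ u, b u ^ 2) / 2) := by
  simp only [Real.exp_sum]
  rw [expect_pi_prod (fun u g => Real.exp (b u * ε g)), Finset.sum_div, Real.exp_sum]
  refine Finset.prod_le_prod (fun u _ => Finset.expect_nonneg fun g _ => (Real.exp_pos _).le)
    fun u _ => ?_
  have h : ∀ g, Real.exp (b u * ε g) = Real.cosh (b u) + Real.sinh (b u) * ε g := by
    intro g
    rcases mul_self_eq_one_iff.1 (by rw [← sq]; exact h1 g : ε g * ε g = 1) with h | h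
    all_goals rw [h]
    · rw [mul_one, mul_one, Real.cosh_add_sinh]
    · rw [mul_neg_one, mul_neg_one, ← sub_eq_add_neg, Real.cosh_sub_sinh]
  simp only [h]
  rw [Finset.expect_add_distrib, ← Finset.mul_expect, h0, mul_zero, add_zero,
    Fintype.expect_const]
  exact Real.cosh_le_exp_half_sq _

/-- Khintchine's inequality for even moments. -/
lemma khintchine (ε : Γ → ℝ) (h1 : ∀ g, ε g ^ 2 = 1) (h0 : 𝔼 g, ε g = 0)
    (b : ι → ℝ) (p : ℕ) (hp : 1 ≤ p) :
    𝔼 x : ι → Γ, (∑ u, b u * ε (x u)) ^ (2 * p) ≤ (12 * p) ^ p * (∑ u, b u ^ 2) ^ p := by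
  have hp0 : (0 : ℝ) < p := by exact_mod_cast hp
  set R := ∑ u, b u ^ 2 with hR
  have hRnn : 0 ≤ R := Finset.sum_nonneg fun u _ => sq_nonneg (b u)
  rcases hRnn.eq_or_lt with h | h
  · have hb : ∀ u, b u = 0 := fun u => by
      have := (Finset.sum_eq_zero_iff_of_nonneg fun u _ => sq_nonneg (b u)).1 h.symm u (mem_univ u)
      simpa using this
    have : ∀ x : ι → Γ, (∑ u, b u * ε (x u)) ^ (2 * p) = 0 := fun x => by
      simp [hb]; omega
    simp only [this, Fintype.expect_const]
    positivity
  -- This choice makes the sub-Gaussian exponent `l ^ 2 * R / 2` equal to `p`. The moment is then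
  -- read off from one term of the exponential series, with `(2p)! ≤ (2p) ^ (2p)` and `2 * e ^ p ≤ 6
  -- ^ p` producing the constant `12`.
  · set l := Real.sqrt (2 * p / R) with hl
    have hl2 : l ^ 2 = 2 * p / R := Real.sq_sqrt (by positivity)
    have hl0 : 0 < l := Real.sqrt_pos.2 (by positivity)
    have hexp : ∀ x : ι → Γ, (l * ∑ u, b u * ε (x u)) ^ (2 * p) ≤
        (2 * p).factorial * (Real.exp (∑ u, (l * b u) * ε (x u)) +
          Real.exp (∑ u, (-l * b u) * ε (x u))) := by
      intro x
      set X := ∑ u, b u * ε (x u)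
      have e1 : ∑ u, (l * b u) * ε (x u) = l * X := by
        simp only [X, Finset.mul_sum, mul_assoc]
      have e2 : ∑ u, (-l * b u) * ε (x u) = -(l * X) := by
        simp only [X, Finset.mul_sum, mul_assoc, neg_mul, Finset.sum_neg_distrib]
      rw [e1, e2]
      have h3 := Real.pow_div_factorial_le_exp |l * X| (abs_nonneg _) (2 * p)
      rw [div_le_iff₀ (by positivity), Even.pow_abs ⟨p, two_mul p⟩] at h3
      refine h3.trans ?_
      rw [mul_comm]
      gcongr
      rcases abs_choice (l * X) with h | h <;> rw [h] <;>
        linarith [Real.exp_pos (l * X), Real.exp_pos (-(l * X))]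
    have hE : l ^ (2 * p) * 𝔼 x : ι → Γ, (∑ u, b u * ε (x u)) ^ (2 * p) ≤
        (2 * p).factorial * (2 * Real.exp p) := by
      have hq : ∀ l' : ℝ, l' ^ 2 = 2 * p / R → (∑ u, (l' * b u) ^ 2) / 2 = p := by
        intro l' hl'
        simp only [mul_pow, ← Finset.mul_sum, hl', ← hR]
        field_simp
      rw [Finset.mul_expect]
      simp only [← mul_pow]
      refine (Finset.expect_le_expect fun x _ => hexp x).trans ?_
      rw [← Finset.mul_expect, Finset.expect_add_distrib]
      gcongr
      have i1 := expect_exp_rademacher ε h1 h0 (fun u => l * b u)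
      have i2 := expect_exp_rademacher ε h1 h0 (fun u => -l * b u)
      rw [hq l hl2] at i1
      rw [hq (-l) (by rw [neg_sq, hl2])] at i2
      linarith
    have hlp : l ^ (2 * p) = (2 * p) ^ p / R ^ p := by
      rw [pow_mul, hl2, div_pow]
    rw [hlp] at hE
    have hfac : ((2 * p).factorial : ℝ) ≤ (2 * p) ^ p * (2 * p) ^ p := by
      rw [← pow_add, ← two_mul]
      exact_mod_cast Nat.factorial_le_pow (2 * p)
    have he : Real.exp p ≤ 3 ^ p := by
      rw [← Real.exp_one_pow]
      exact pow_le_pow_left₀ (Real.exp_pos 1).le (by linarith [Real.exp_one_lt_d9]) p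
    set Z := 𝔼 x : ι → Γ, (∑ u, b u * ε (x u)) ^ (2 * p)
    have h2p : (2 : ℝ) ≤ 2 ^ p := by
      calc (2 : ℝ) = 2 ^ 1 := by norm_num
        _ ≤ 2 ^ p := pow_le_pow_right₀ (by norm_num) hp
    have hpos : (0 : ℝ) < (2 * p) ^ p := by positivity
    have hRp : 0 < R ^ p := by positivity
    have : (2 * (p : ℝ)) ^ p / R ^ p * Z ≤ (2 * p) ^ p * ((2 * p) ^ p * (2 ^ p * 3 ^ p)) := by
      refine hE.trans ?_
      rw [← mul_assoc ((2 * (p : ℝ)) ^ p)]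
      exact mul_le_mul hfac (mul_le_mul h2p he (Real.exp_pos _).le (by positivity))
        (by positivity) (by positivity)
    rw [div_mul_eq_mul_div, div_le_iff₀ hRp, mul_assoc] at this
    have := le_of_mul_le_mul_left this hpos
    calc Z ≤ _ := this
      _ = (12 * p) ^ p * R ^ p := by
        rw [← mul_pow, ← mul_pow]; congr 2; ring

/-- Decoupling: for fixed `y` the form is linear in the signs of `x`, so Khintchine applies with
coefficients `b y u`. The sum of their squares is then handled by Jensen with weights `w u / R` and
a second use of Khintchine in `y`. -/
lemma bilinear_khintchine (ε : Γ → ℝ) (h1 : ∀ g, ε g ^ 2 = 1) (h0 : 𝔼 g, ε g = 0)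
    (a : ι → κ → ℝ) (p : ℕ) (hp : 1 ≤ p) :
    𝔼 θ : (ι → Γ) × (κ → Γ), (∑ u, ∑ v, a u v * (ε (θ.1 u) * ε (θ.2 v))) ^ (2 * p) ≤
      (12 * p) ^ (2 * p) * (∑ u, ∑ v, a u v ^ 2) ^ p := by
  have hp0 : (0 : ℝ) < p := by exact_mod_cast hp
  set w : ι → ℝ := fun u => ∑ v, a u v ^ 2 with hw
  have hw0 : ∀ u, 0 ≤ w u := fun u => Finset.sum_nonneg fun v _ => sq_nonneg _
  set R := ∑ u, w u with hR
  set b : (κ → Γ) → ι → ℝ := fun y u => ∑ v, a u v * ε (y v) with hb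
  have hb0 : ∀ y u, w u = 0 → b y u = 0 := by
    intro y u h
    refine Finset.sum_eq_zero fun v _ => ?_
    have := (Finset.sum_eq_zero_iff_of_nonneg fun v _ => sq_nonneg (a u v)).1 h v (mem_univ v)
    rw [sq_eq_zero_iff.1 this, zero_mul]
  have hstep : ∀ y, 𝔼 x : ι → Γ, (∑ u, ∑ v, a u v * (ε (x u) * ε (y v))) ^ (2 * p) ≤
      (12 * p) ^ p * (∑ u, b y u ^ 2) ^ p := by
    intro y
    have : ∀ x : ι → Γ, ∑ u, ∑ v, a u v * (ε (x u) * ε (y v)) = ∑ u, b y u * ε (x u) := by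
      intro x
      refine Finset.sum_congr rfl fun u _ => ?_
      rw [hb, Finset.sum_mul]
      exact Finset.sum_congr rfl fun v _ => by ring
    simp only [this]
    exact khintchine ε h1 h0 (b y) p hp
  have hjen : ∀ y, (∑ u, b y u ^ 2) ^ p ≤ R ^ p * ∑ u, w u / R * (b y u ^ 2 / w u) ^ p := by
    intro y
    have hRnn : 0 ≤ R := Finset.sum_nonneg fun u _ => hw0 u
    rcases hRnn.eq_or_lt with h | h
    · have hz : ∀ u, b y u = 0 := fun u => hb0 y u
        ((Finset.sum_eq_zero_iff_of_nonneg fun u _ => hw0 u).1 h.symm u (mem_univ u))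
      simp only [hz, zero_pow (two_ne_zero), Finset.sum_const_zero, ← h,
        zero_pow (by omega : p ≠ 0), zero_mul, le_refl]
    · have hj := Real.pow_arith_mean_le_arith_mean_pow univ (fun u => w u / R)
        (fun u => b y u ^ 2 / w u) (fun u _ => div_nonneg (hw0 u) h.le)
        (by rw [← Finset.sum_div, ← hR, div_self h.ne'])
        (fun u _ => div_nonneg (sq_nonneg _) (hw0 u)) p
      have e : ∑ u, b y u ^ 2 = R * ∑ u, w u / R * (b y u ^ 2 / w u) := by
        rw [Finset.mul_sum]
        refine Finset.sum_congr rfl fun u _ => ?_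
        rcases (hw0 u).eq_or_lt with h' | h'
        · simp [hb0 y u h'.symm]
        · field_simp
      rw [e, mul_pow]
      gcongr
  have hexp : 𝔼 y : κ → Γ, (∑ u, b y u ^ 2) ^ p ≤ (12 * p) ^ p * R ^ p := by
    refine (Finset.expect_le_expect fun y _ => hjen y).trans ?_
    rw [← Finset.mul_expect, mul_comm]
    have hR0 : 0 ≤ R := Finset.sum_nonneg fun u _ => hw0 u
    gcongr
    rw [Finset.expect_sum_comm]
    have hu : ∀ u, 𝔼 y : κ → Γ, w u / R * (b y u ^ 2 / w u) ^ p ≤ w u / R * (12 * p) ^ p := by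
      intro u
      rw [← Finset.mul_expect]
      refine mul_le_mul_of_nonneg_left ?_ (div_nonneg (hw0 u) hR0)
      have hk := khintchine ε h1 h0 (a u) p hp
      rcases (hw0 u).eq_or_lt with h' | h'
      · simp only [← h', div_zero, zero_pow (by omega : p ≠ 0), Fintype.expect_const]
        positivity
      · simp only [div_pow, ← Finset.expect_div, ← pow_mul]
        rw [div_le_iff₀ (by positivity)]
        exact hk
    refine (Finset.sum_le_sum fun u _ => hu u).trans ?_
    rw [← Finset.sum_mul, ← Finset.sum_div, ← hR]
    exact mul_le_of_le_one_left (by positivity) (div_self_le_one R)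
  rw [← Finset.univ_product_univ, Finset.expect_product, Finset.expect_comm]
  refine (Finset.expect_le_expect fun y _ => hstep y).trans ?_
  rw [← Finset.mul_expect, two_mul p, pow_add, mul_assoc]
  gcongr

/-- Jensen's inequality for the even power `2 * p` under the probability density proportional to
`g`. -/
lemma expect_mul_pow_le (g B : Θ → ℝ) (hg : ∀ θ, 0 ≤ g θ) (p : ℕ) (hp : 1 ≤ p) :
    (𝔼 θ, g θ * B θ) ^ (2 * p) ≤ (𝔼 θ, g θ) ^ (2 * p - 1) * 𝔼 θ, g θ * B θ ^ (2 * p) := by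
  set P := 𝔼 θ, g θ with hP
  have hPnn : 0 ≤ P := Finset.expect_nonneg fun θ _ => hg θ
  rcases hPnn.eq_or_lt with h | h
  · have hz : ∀ θ, g θ = 0 := fun θ =>
      (Finset.expect_eq_zero_iff_of_nonneg fun θ _ => hg θ).1 h.symm θ (mem_univ θ)
    simp only [hz, zero_mul, Fintype.expect_eq_sum_div_card, Finset.sum_const_zero, zero_div,
      mul_zero]
    rw [zero_pow (by omega)]
  · have hne : Nonempty Θ := by
      by_contra hemp
      rw [not_nonempty_iff] at hemp
      simp [hP] at h
    have hc : (0 : ℝ) < Fintype.card Θ := by exact_mod_cast Fintype.card_pos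
    have hPc : ∑ θ, g θ = P * Fintype.card Θ := by
      rw [hP, Fintype.expect_eq_sum_div_card]; field_simp
    have hj := Real.pow_arith_mean_le_arith_mean_pow_of_even univ
      (fun θ => g θ / (P * Fintype.card Θ)) B (fun θ _ => div_nonneg (hg θ) (by positivity))
      (by rw [← Finset.sum_div, hPc, div_self (by positivity)]) (n := 2 * p) ⟨p, two_mul p⟩
    have e : ∀ f : Θ → ℝ, ∑ θ, g θ / (P * Fintype.card Θ) * f θ = (𝔼 θ, g θ * f θ) / P := by
      intro f
      rw [Fintype.expect_eq_sum_div_card, Finset.sum_div, Finset.sum_div]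
      exact Finset.sum_congr rfl fun θ _ => by field_simp
    rw [e, e (fun θ => B θ ^ (2 * p)), div_pow, div_le_div_iff₀ (by positivity) h] at hj
    have h2 : P ^ (2 * p) = P ^ (2 * p - 1) * P := by
      rw [← pow_succ]; congr 1; omega
    rw [h2, ← mul_assoc] at hj
    have := le_of_mul_le_mul_right hj h
    linarith

/-- Level-two inequality for a random message of `s` bits about a random sign pattern. -/
lemma level_two {S : Type} [Fintype S] (ε : Γ → ℝ) (h1 : ∀ g, ε g ^ 2 = 1) (h0 : 𝔼 g, ε g = 0)
    (g : S → (ι → Γ) × (κ → Γ) → ℝ) (hg0 : ∀ σ θ, 0 ≤ g σ θ) (hg1 : ∀ θ, ∑ σ, g σ θ = 1)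
    (s : ℕ) (hS : Fintype.card S ≤ 2 ^ s) :
    ∑ σ, (∑ u, ∑ v, (𝔼 θ, g σ θ * (ε (θ.1 u) * ε (θ.2 v))) ^ 2) / 𝔼 θ, g σ θ ≤
      2 * (12 * (s + 1)) ^ 2 := by
  set P : S → ℝ := fun σ => 𝔼 θ, g σ θ with hP
  set a : S → ι → κ → ℝ := fun σ u v => 𝔼 θ, g σ θ * (ε (θ.1 u) * ε (θ.2 v)) with ha
  set R : S → ℝ := fun σ => ∑ u, ∑ v, a σ u v ^ 2 with hR
  have hR0 : ∀ σ, 0 ≤ R σ := fun σ =>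
    Finset.sum_nonneg fun u _ => Finset.sum_nonneg fun v _ => sq_nonneg _
  have hP0 : ∀ σ, 0 ≤ P σ := fun σ => Finset.expect_nonneg fun θ _ => hg0 σ θ
  have hP1 : ∑ σ, P σ = 1 := by
    rw [hP, ← Finset.expect_sum_comm]
    simp [hg1]
  have hg_le : ∀ σ θ, g σ θ ≤ 1 := fun σ θ => by
    rw [← hg1 θ]
    exact Finset.single_le_sum (f := fun σ => g σ θ) (fun σ _ => hg0 σ θ) (mem_univ σ)
  -- Test the message against the bilinear form `B` whose coefficients are its own Fourier
  -- coefficients `a σ`, so that `𝔼 g * B = R`. Jensen and the moment bound give an upper bound for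
  -- `R ^ (2 * (s + 1))` that contains `R ^ (s + 1)`, one copy of which cancels.
  have key : ∀ σ, P σ * (R σ / P σ ^ 2) ^ (s + 1) ≤ ((12 * (s + 1)) ^ 2) ^ (s + 1) := by
    intro σ
    rcases (hP0 σ).eq_or_lt with h | h
    · rw [← h, zero_mul]; positivity
    rcases (hR0 σ).eq_or_lt with hr | hr
    · rw [← hr]; simp; positivity
    set B : (ι → Γ) × (κ → Γ) → ℝ := fun θ => ∑ u, ∑ v, a σ u v * (ε (θ.1 u) * ε (θ.2 v))
    have e : 𝔼 θ, g σ θ * B θ = R σ := by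
      simp only [B, Finset.mul_sum, R]
      rw [Finset.expect_sum_comm]
      refine Finset.sum_congr rfl fun u _ => ?_
      rw [Finset.expect_sum_comm]
      refine Finset.sum_congr rfl fun v _ => ?_
      rw [sq]
      conv_rhs => rw [ha]
      rw [Finset.mul_expect]
      exact Finset.expect_congr rfl fun θ _ => by simp only [ha]; ring
    have i1 := expect_mul_pow_le (g σ) B (hg0 σ) (s + 1) (by omega)
    have i2 : 𝔼 θ, g σ θ * B θ ^ (2 * (s + 1)) ≤ 𝔼 θ, B θ ^ (2 * (s + 1)) :=
      Finset.expect_le_expect fun θ _ => mul_le_of_le_one_left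
        (by rw [pow_mul]; positivity) (hg_le σ θ)
    have i3 := bilinear_khintchine ε h1 h0 (a σ) (s + 1) (by omega)
    rw [e] at i1
    have i4 : R σ ^ (2 * (s + 1)) ≤ P σ ^ (2 * (s + 1) - 1) *
        ((12 * ((s + 1 : ℕ) : ℝ)) ^ (2 * (s + 1)) * R σ ^ (s + 1)) :=
      i1.trans (mul_le_mul_of_nonneg_left (i2.trans i3) (by positivity))
    rw [two_mul (s + 1), pow_add (R σ), ← mul_assoc] at i4
    have i5 := le_of_mul_le_mul_right i4 (by positivity)
    rw [div_pow, ← pow_mul, mul_div_assoc', div_le_iff₀ (by positivity)]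
    have h2 : P σ ^ (2 * (s + 1)) = P σ ^ (2 * (s + 1) - 1) * P σ := by
      rw [← pow_succ]; congr 1
    rw [h2, ← pow_mul, two_mul (s + 1)]
    push_cast at i5
    calc P σ * R σ ^ (s + 1) ≤ P σ * _ := mul_le_mul_of_nonneg_left i5 h.le
      _ = _ := by ring
  -- The moment order `s + 1` is chosen so that the number `2 ^ s` of messages contributes only a
  -- factor `2` after taking the root.
  have hj := Real.pow_arith_mean_le_arith_mean_pow univ P (fun σ => R σ / P σ ^ 2)
    (fun σ _ => hP0 σ) hP1 (fun σ _ => div_nonneg (hR0 σ) (by positivity)) (s + 1)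
  have hsum : ∑ σ, P σ * (R σ / P σ ^ 2) ^ (s + 1) ≤ (2 * (12 * (s + 1)) ^ 2) ^ (s + 1) := by
    refine (Finset.sum_le_card_nsmul _ _ _ fun σ _ => key σ).trans ?_
    rw [nsmul_eq_mul, mul_pow 2]
    have hpos : (0 : ℝ) ≤ ((12 * ((s : ℝ) + 1)) ^ 2) ^ (s + 1) := by positivity
    refine mul_le_mul_of_nonneg_right ?_ hpos
    calc ((univ : Finset S).card : ℝ) ≤ 2 ^ s := by exact_mod_cast hS
      _ ≤ 2 ^ (s + 1) := pow_le_pow_right₀ (by norm_num) (by omega)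
  have hfin := le_of_pow_le_pow_left₀ (by omega : s + 1 ≠ 0) (by positivity) (hj.trans hsum)
  refine le_trans (le_of_eq (Finset.sum_congr rfl fun σ _ => ?_)) hfin
  change R σ / P σ = _
  rcases (hP0 σ).eq_or_lt with h | h
  · simp [← h]
  · field_simp

end Khintchine

/-! ### Fourier analysis on `(ZMod 2) ^ k` -/

section Characters

variable {k : ℕ}

/-- The nontrivial sign character of `ZMod 2`. -/
def sgn (a : ZMod 2) : ℝ := if a = 0 then 1 else -1

lemma sgn_add (a b : ZMod 2) : sgn (a + b) = sgn a * sgn b := by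
  have h : ∀ a : ZMod 2, a = 0 ∨ a = 1 := by decide
  have h11 : (1 : ZMod 2) + 1 = 0 := by decide
  rcases h a with rfl | rfl <;> rcases h b with rfl | rfl <;> simp [sgn, h11]

lemma sgn_sq (a : ZMod 2) : sgn a ^ 2 = 1 := by
  unfold sgn; split_ifs <;> norm_num

/-- The characters of `(ZMod 2) ^ k`. -/
def chi (r : Finset (Fin k)) (z : Fin k → ZMod 2) : ℝ := ∏ i ∈ r, sgn (z i)

lemma chi_add (r : Finset (Fin k)) (z w : Fin k → ZMod 2) :
    chi r (z + w) = chi r z * chi r w := by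
  simp [chi, sgn_add, Finset.prod_mul_distrib]

lemma chi_sq (r : Finset (Fin k)) (z : Fin k → ZMod 2) : chi r z ^ 2 = 1 := by
  simp [chi, ← Finset.prod_pow, sgn_sq]

lemma chi_empty (z : Fin k → ZMod 2) : chi ∅ z = 1 := by simp [chi]

lemma sum_chi (r : Finset (Fin k)) (hr : r.Nonempty) : ∑ z, chi r z = 0 := by
  obtain ⟨i, hi⟩ := hr
  have h : chi r (Pi.single i 1) = -1 := by
    unfold chi
    rw [Finset.prod_eq_single i]
    · simp [sgn]
    · intro j _ hj; simp [sgn, hj]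
    · exact fun h => absurd hi h
  have h2 : ∑ z, chi r z = ∑ z, chi r (z + Pi.single i 1) :=
    (Equiv.sum_comp (Equiv.addRight (Pi.single i 1)) (chi r)).symm
  simp only [chi_add, h, mul_neg, mul_one, Finset.sum_neg_distrib] at h2
  linarith

lemma sum_chi_mul_chi (z w : Fin k → ZMod 2) :
    ∑ r, chi r z * chi r w = if z = w then (2 : ℝ) ^ k else 0 := by
  have h : ∀ r : Finset (Fin k), chi r z * chi r w = ∏ i ∈ r, sgn (z i + w i) := fun r => by
    rw [← chi_add]; rfl
  simp only [h]
  rw [← Finset.powerset_univ, ← Finset.prod_one_add]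
  split_ifs with hzw
  · subst hzw
    have h0 : ∀ a : ZMod 2, a + a = 0 := by decide
    simp [h0, sgn]
    norm_num
  · obtain ⟨i, hi⟩ := Function.ne_iff.1 hzw
    refine Finset.prod_eq_zero (mem_univ i) ?_
    have h0 : ∀ a b : ZMod 2, a ≠ b → a + b ≠ 0 := by decide
    simp [sgn, h0 _ _ hi]

lemma parseval (ρ : (Fin k → ZMod 2) → ℝ) :
    ∑ r, (∑ z, ρ z * chi r z) ^ 2 = 2 ^ k * ∑ z, ρ z ^ 2 := by
  have h : ∀ r, (∑ z, ρ z * chi r z) ^ 2 = ∑ z, ∑ w, ρ z * ρ w * (chi r z * chi r w) := by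
    intro r
    rw [sq, Finset.sum_mul_sum]
    exact Finset.sum_congr rfl fun z _ => Finset.sum_congr rfl fun w _ => by ring
  simp only [h]
  rw [Finset.sum_comm, Finset.mul_sum]
  refine Finset.sum_congr rfl fun z _ => ?_
  rw [Finset.sum_comm]
  simp only [← Finset.mul_sum, sum_chi_mul_chi, mul_ite, mul_zero, Finset.sum_ite_eq, mem_univ,
    if_true]
  ring

end Characters

/-! ### Processes whose state carries little information -/

section SequentialProcess

variable {k : ℕ} {Θ C S : Type} [Fintype Θ] [Fintype C] [Fintype S] [DecidableEq S]

/-- The variance of a function on a finite uniform probability space. -/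
def var {E : Type} [Fintype E] (F : E → ℝ) : ℝ := 𝔼 e, (F e - 𝔼 e', F e') ^ 2

lemma expect_sub_sq {E : Type} [Fintype E] [Nonempty E] (F : E → ℝ) (a : ℝ) :
    𝔼 e, (F e - a) ^ 2 = var F + (𝔼 e, F e - a) ^ 2 := by
  set μ := 𝔼 e, F e with hμ
  have h : ∀ e, (F e - a) ^ 2 = (F e - μ) ^ 2 + (2 * (μ - a) * F e + (a ^ 2 - μ ^ 2)) := fun e => by
    ring
  simp only [h, Finset.expect_add_distrib, ← Finset.mul_expect, Fintype.expect_const, ← hμ]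
  rw [var, ← hμ]; ring

lemma expect_sq_eq {E : Type} [Fintype E] [Nonempty E] (F : E → ℝ) :
    𝔼 e, F e ^ 2 = var F + (𝔼 e, F e) ^ 2 := by
  simpa using expect_sub_sq F 0

/-- Squaring is `2`-Lipschitz on `[0, 1]`, and the second moment about `μ ^ 2` bounds the variance
from above. -/
lemma var_sq_le {E : Type} [Fintype E] [Nonempty E] (F : E → ℝ) (h0 : ∀ e, 0 ≤ F e)
    (h1 : ∀ e, F e ≤ 1) : var (fun e => F e ^ 2) ≤ 4 * var F := by
  set μ := 𝔼 e, F e with hμ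
  have hμ0 : 0 ≤ μ := Finset.expect_nonneg fun e _ => h0 e
  have hμ1 : μ ≤ 1 := (Finset.expect_le_expect fun e _ => h1 e).trans (by simp)
  have h := expect_sub_sq (fun e => F e ^ 2) (μ ^ 2)
  have h2 : 𝔼 e, (F e ^ 2 - μ ^ 2) ^ 2 ≤ 4 * var F := by
    rw [var, Finset.mul_expect]
    refine Finset.expect_le_expect fun e _ => ?_
    have : (F e ^ 2 - μ ^ 2) ^ 2 = (F e + μ) ^ 2 * (F e - μ) ^ 2 := by ring
    rw [this]
    refine mul_le_mul_of_nonneg_right ?_ (sq_nonneg _)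
    nlinarith [h0 e, h1 e]
  nlinarith [sq_nonneg ((𝔼 e, F e ^ 2) - μ ^ 2)]

/-- The chi-square information that a message with likelihood `g` carries about the label
`z θ c` of a random `c`, weighted with the probability of the message. -/
def info (z : Θ → C → Fin k → ZMod 2) (g : Θ → ℝ) : ℝ :=
  (𝔼 c, ∑ r ∈ univ.erase ∅, (𝔼 θ, g θ * chi r (z θ c)) ^ 2) / 𝔼 θ, g θ

/-- The change of an expectation caused by a message is controlled by its information. -/
lemma abs_expect_sub_le (z : Θ → C → Fin k → ZMod 2) (g : Θ → ℝ) (hg : ∀ θ, 0 ≤ g θ)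
    (F : C × (Fin k → ZMod 2) → ℝ) (l : ℝ) (hl : 0 < l) :
    |𝔼 θ, g θ * (𝔼 c, F (c, z θ c)) - (𝔼 θ, g θ) * 𝔼 e, F e| ≤
      l * info z g + (𝔼 θ, g θ) * var F / (4 * l) := by
  set P := 𝔼 θ, g θ with hP
  have hP0 : 0 ≤ P := Finset.expect_nonneg fun θ _ => hg θ
  rcases hP0.eq_or_lt with h | h
  · have hz : ∀ θ, g θ = 0 := fun θ =>
      (Finset.expect_eq_zero_iff_of_nonneg fun θ _ => hg θ).1 h.symm θ (mem_univ θ)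
    simp [hz, info, ← h]
  have hq : (0 : ℝ) < 2 ^ k := by positivity
  have hcard : (Fintype.card (Fin k → ZMod 2) : ℝ) = 2 ^ k := by
    simp [ZMod.card]
  set μ := 𝔼 e, F e with hμ
  -- `d c` is the deviation of the `g`-weighted law of the label at `c` from the uniform law of the
  -- same mass. Its total is zero, so `F` may be centred and the trivial character drops out of
  -- Parseval's identity.
  set d : C → (Fin k → ZMod 2) → ℝ := fun c w =>
    (𝔼 θ, g θ * if z θ c = w then 1 else 0) - P / 2 ^ k with hd
  have hdsum : ∀ (c : C) (φ : (Fin k → ZMod 2) → ℝ),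
      ∑ w, d c w * φ w = (𝔼 θ, g θ * φ (z θ c)) - P * 𝔼 w, φ w := by
    intro c φ
    simp only [hd, sub_mul, Finset.sum_sub_distrib, Finset.expect_mul]
    congr 1
    · rw [← Finset.expect_sum_comm]
      refine Finset.expect_congr rfl fun θ _ => ?_
      simp
    · rw [Fintype.expect_eq_sum_div_card, hcard, ← Finset.mul_sum]; ring
  have hd1 : ∀ c, ∑ w, d c w = 0 := fun c => by
    have := hdsum c fun _ => 1
    simpa [← hP] using this
  have hprod : ∀ f : C × (Fin k → ZMod 2) → ℝ, 𝔼 e, f e = 𝔼 c, 𝔼 w, f (c, w) := fun f => by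
    rw [← Finset.univ_product_univ, Finset.expect_product]
  have hmain : 𝔼 θ, g θ * (𝔼 c, F (c, z θ c)) - P * μ = 𝔼 c, ∑ w, d c w * (F (c, w) - μ) := by
    have : ∀ c, ∑ w, d c w * (F (c, w) - μ) = (𝔼 θ, g θ * F (c, z θ c)) - P * 𝔼 w, F (c, w) := by
      intro c
      simp only [mul_sub, Finset.sum_sub_distrib, ← Finset.sum_mul, hd1, zero_mul, sub_zero]
      exact hdsum c fun w => F (c, w)
    simp only [this, Finset.expect_sub_distrib, ← Finset.mul_expect]
    rw [hμ, hprod]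
    simp only [Finset.mul_expect]
    congr 1
    exact Finset.expect_comm _ _ _
  have hpars : ∀ c, 2 ^ k * ∑ w, d c w ^ 2 =
      ∑ r ∈ univ.erase ∅, (𝔼 θ, g θ * chi r (z θ c)) ^ 2 := by
    intro c
    rw [← parseval, ← Finset.add_sum_erase _ _ (mem_univ ∅)]
    simp only [chi_empty, mul_one, hd1]
    rw [zero_pow two_ne_zero, zero_add]
    refine Finset.sum_congr rfl fun r hr => ?_
    rw [hdsum, Fintype.expect_eq_sum_div_card (chi r),
      sum_chi r (Finset.nonempty_iff_ne_empty.2 (Finset.ne_of_mem_erase hr))]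
    simp
  -- A weighted AM-GM inequality replaces Cauchy–Schwarz: it keeps the information and the variance
  -- as separate summands, which can be added up over the steps of a process.
  have hamgm : ∀ c, |∑ w, d c w * (F (c, w) - μ)| ≤
      l / P * (2 ^ k * ∑ w, d c w ^ 2) + P / (4 * l) * 𝔼 w, (F (c, w) - μ) ^ 2 := by
    intro c
    refine (Finset.abs_sum_le_sum_abs _ _).trans ?_
    rw [Fintype.expect_eq_sum_div_card, hcard, Finset.mul_sum, Finset.mul_sum, Finset.sum_div,
      Finset.mul_sum, ← Finset.sum_add_distrib]
    refine Finset.sum_le_sum fun w _ => ?_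
    generalize d c w = x
    generalize F (c, w) - μ = y
    have hA : 0 < l * 2 ^ k / P := by positivity
    have e1 : l / P * (2 ^ k * x ^ 2) = (l * 2 ^ k / P) * x ^ 2 := by ring
    have e2 : P / (4 * l) * (y ^ 2 / 2 ^ k) = y ^ 2 / (4 * (l * 2 ^ k / P)) := by
      field_simp
    rw [e1, e2]
    generalize l * 2 ^ k / P = A at hA ⊢
    rw [← sub_nonneg]
    have e3 : A * x ^ 2 + y ^ 2 / (4 * A) - |x * y| = (2 * A * |x| - |y|) ^ 2 / (4 * A) := by
      rw [abs_mul]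
      field_simp
      rw [← sq_abs x, ← sq_abs y]
      ring
    rw [e3]; positivity
  simp only [hpars] at hamgm
  rw [hmain]
  refine (Finset.abs_expect_le _ _).trans ((Finset.expect_le_expect fun c _ => hamgm c).trans ?_)
  rw [Finset.expect_add_distrib, ← Finset.mul_expect, ← Finset.mul_expect]
  rw [var, hprod, info, ← hP]
  apply le_of_eq
  ring

/-- The state of a sequential process after `t` inputs. -/
def runSteps {E S : Type} (f : ℕ → S → E → S) (σ₀ : S) : (t : ℕ) → (Fin t → E) → S
  | 0, _ => σ₀
  | t + 1, e => f t (runSteps f σ₀ t (Fin.init e)) (e (Fin.last t))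

lemma expect_snoc {E : Type} [Fintype E] (t : ℕ) (F : (Fin (t + 1) → E) → ℝ) :
    𝔼 e, F e = 𝔼 e : Fin t → E, 𝔼 c, F (Fin.snoc e c) := by
  rw [Finset.expect_comm,
    ← Finset.expect_product' univ univ fun c e => F (Fin.snoc (α := fun _ => E) e c),
    Finset.univ_product_univ]
  exact (Fintype.expect_equiv (Fin.snocEquiv fun _ : Fin (t + 1) => E) _ _ fun x => rfl).symm

/-- The expected final value `h` of the process after `m` uniform inputs, given that its state
is `σ` with `r` inputs still to come. -/
def valueToGo {E S : Type} [Fintype E] (f : ℕ → S → E → S) (h : S → ℝ) (m : ℕ) : ℕ → S → ℝ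
  | 0, σ => h σ
  | r + 1, σ => 𝔼 e, valueToGo f h m r (f (m - (r + 1)) σ e)

lemma valueToGo_mem {E S : Type} [Fintype E] [Nonempty E] (f : ℕ → S → E → S) (h : S → ℝ)
    (hh : ∀ σ, 0 ≤ h σ ∧ h σ ≤ 1) (m r : ℕ) (σ : S) :
    0 ≤ valueToGo f h m r σ ∧ valueToGo f h m r σ ≤ 1 := by
  induction r generalizing σ with
  | zero => exact hh σ
  | succ r ih =>
    refine ⟨Finset.expect_nonneg fun e _ => (ih _).1, ?_⟩
    exact (Finset.expect_le_expect fun e _ => (ih _).2).trans (by simp)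

lemma valueToGo_sub {E S : Type} [Fintype E] (f : ℕ → S → E → S) (h : S → ℝ) {m t : ℕ}
    (ht : t < m) (σ : S) :
    valueToGo f h m (m - t) σ = 𝔼 e, valueToGo f h m (m - (t + 1)) (f t σ e) := by
  obtain ⟨r, hr⟩ : ∃ r, m - t = r + 1 := ⟨m - t - 1, by omega⟩
  have h1 : m - (t + 1) = r := by omega
  have h2 : m - (r + 1) = t := by omega
  rw [hr, h1, valueToGo, h2]

lemma expect_runSteps {E S : Type} [Fintype E] [Nonempty E] (f : ℕ → S → E → S) (σ₀ : S)
    (h : S → ℝ) (m : ℕ) :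
    𝔼 e, h (runSteps f σ₀ m e) = valueToGo f h m m σ₀ := by
  have key : ∀ t ≤ m, 𝔼 e, valueToGo f h m (m - t) (runSteps f σ₀ t e) =
      valueToGo f h m m σ₀ := by
    intro t
    induction t with
    | zero => intro _; simp [runSteps]
    | succ t ih =>
      intro ht
      rw [← ih (by omega), expect_snoc]
      refine Finset.expect_congr rfl fun e _ => ?_
      rw [valueToGo_sub f h ht]
      refine Finset.expect_congr rfl fun c _ => ?_
      simp [runSteps]
  have := key m le_rfl
  rwa [Nat.sub_self] at this

/-- A process whose state carries little information about the hidden parameter `θ` hardly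
distinguishes the labels `z θ c` from uniform ones. -/
theorem abs_process_sub_le [Nonempty Θ] [Nonempty C] (z : Θ → C → Fin k → ZMod 2) (ε : ℝ)
    (hinfo : ∀ g : S → Θ → ℝ, (∀ σ θ, 0 ≤ g σ θ) → (∀ θ, ∑ σ, g σ θ = 1) →
      ∑ σ, info z (g σ) ≤ ε)
    (f : ℕ → S → C × (Fin k → ZMod 2) → S) (σ₀ : S) (h : S → ℝ)
    (hh : ∀ σ, 0 ≤ h σ ∧ h σ ≤ 1) (m : ℕ) (hm : m * ε ≤ 1) (l : ℝ) (hl : 0 < l) :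
    |𝔼 θ, 𝔼 c : Fin m → C, h (runSteps f σ₀ m fun i => (c i, z θ (c i))) - 𝔼 e, h (runSteps f σ₀ m e)| ≤
      l * (m * ε) + 3 / (2 * l) := by
  let A : ℕ → (S → ℝ) → ℝ := fun t φ =>
    𝔼 θ, 𝔼 c : Fin t → C, φ (runSteps f σ₀ t fun i => (c i, z θ (c i)))
  let g : ℕ → S → Θ → ℝ := fun t σ θ =>
    𝔼 c : Fin t → C, if runSteps f σ₀ t (fun i => (c i, z θ (c i))) = σ then 1 else 0
  -- A martingale for uniform inputs; the telescoping increments of its mean under the true inputs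
  -- are the total discrepancy.
  let U : ℕ → S → ℝ := fun t => valueToGo f h m (m - t)
  have hU0 : ∀ t σ, 0 ≤ U t σ := fun t σ => (valueToGo_mem f h hh m _ σ).1
  have hU1 : ∀ t σ, U t σ ≤ 1 := fun t σ => (valueToGo_mem f h hh m _ σ).2
  have hg0 : ∀ t σ θ, 0 ≤ g t σ θ := fun t σ θ =>
    Finset.expect_nonneg fun c _ => by split_ifs <;> norm_num
  have hg1 : ∀ t θ, ∑ σ, g t σ θ = 1 := fun t θ => by
    simp only [g]
    rw [← Finset.expect_sum_comm]
    simp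
  have hsplit : ∀ t (ψ : S → Θ → ℝ),
      𝔼 θ, 𝔼 c : Fin t → C, ψ (runSteps f σ₀ t fun i => (c i, z θ (c i))) θ =
        ∑ σ, 𝔼 θ, g t σ θ * ψ σ θ := by
    intro t ψ
    rw [← Finset.expect_sum_comm]
    refine Finset.expect_congr rfl fun θ _ => ?_
    simp only [g, Finset.expect_mul]
    rw [← Finset.expect_sum_comm]
    simp
  have hAsplit : ∀ t φ, A t φ = ∑ σ, (𝔼 θ, g t σ θ) * φ σ := by
    intro t φ
    rw [show A t φ = _ from hsplit t fun σ _ => φ σ]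
    simp only [Finset.expect_mul]
  have hAsucc : ∀ t φ, A (t + 1) φ = ∑ σ, 𝔼 θ, g t σ θ * 𝔼 c, φ (f t σ (c, z θ c)) := by
    intro t φ
    rw [← hsplit t fun σ θ => 𝔼 c, φ (f t σ (c, z θ c))]
    refine Finset.expect_congr rfl fun θ _ => ?_
    rw [expect_snoc]
    refine Finset.expect_congr rfl fun c _ => Finset.expect_congr rfl fun c' _ => ?_
    simp only [runSteps, Fin.snoc_last]
    congr 2
    congr 1
    funext i
    simp [Fin.init]
  have hAmono : ∀ t (φ ψ : S → ℝ), (∀ σ, φ σ ≤ ψ σ) → A t φ ≤ A t ψ := fun t φ ψ hφ =>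
    Finset.expect_le_expect fun θ _ => Finset.expect_le_expect fun c _ => hφ _
  have hAadd : ∀ t (φ ψ : S → ℝ), A t (fun σ => φ σ + ψ σ) = A t φ + A t ψ := fun t φ ψ => by
    simp only [A, Finset.expect_add_distrib]
  have hAmul : ∀ t (a : ℝ) (φ : S → ℝ), A t (fun σ => a * φ σ) = a * A t φ := fun t a φ => by
    simp only [A, Finset.mul_expect]
  have hAone : ∀ t, A t (fun _ => 1) = 1 := fun t => by simp [A]
  have hAzero : ∀ φ, A 0 φ = φ σ₀ := fun φ => by simp [A, runSteps]
  have hAh : A m h = 𝔼 θ, 𝔼 c : Fin m → C, h (runSteps f σ₀ m fun i => (c i, z θ (c i))) := rfl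
  clear_value A g
  have hstep : ∀ t φ (l : ℝ), 0 < l →
      |A (t + 1) φ - A t (fun σ => 𝔼 e, φ (f t σ e))| ≤
        l * ε + A t (fun σ => var fun e => φ (f t σ e)) / (4 * l) := by
    intro t φ l hl
    rw [hAsucc, hAsplit, hAsplit, ← Finset.sum_sub_distrib]
    refine (Finset.abs_sum_le_sum_abs _ _).trans ?_
    refine (Finset.sum_le_sum fun σ _ =>
      abs_expect_sub_le z (g t σ) (hg0 t σ) (fun e => φ (f t σ e)) l hl).trans ?_
    rw [Finset.sum_add_distrib, ← Finset.mul_sum, ← Finset.sum_div]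
    gcongr
    exact hinfo (g t) (hg0 t) (hg1 t)
  let v : ℕ → ℝ := fun t => A t fun σ => var fun e => U (t + 1) (f t σ e)
  have hUt : ∀ t < m, (fun σ => 𝔼 e, U (t + 1) (f t σ e)) = U t := fun t ht =>
    funext fun σ => (valueToGo_sub f h ht σ).symm
  have hfirst : ∀ t < m, |A (t + 1) (U (t + 1)) - A t (U t)| ≤ l * ε + v t / (4 * l) := by
    intro t ht
    have := hstep t (U (t + 1)) l hl
    rwa [hUt t ht] at this
  -- Under uniform inputs the mean of `U ^ 2` would grow by exactly `v t`. Passing to the true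
  -- inputs with weight `2` costs `2 * ε + 4 * v t / 8`, so half of `v t` survives.
  have hsecond : ∀ t < m, v t / 2 - 2 * ε ≤
      A (t + 1) (fun σ => U (t + 1) σ ^ 2) - A t (fun σ => U t σ ^ 2) := by
    intro t ht
    have h1 := hstep t (fun σ => U (t + 1) σ ^ 2) 2 two_pos
    have h2 : A t (fun σ => 𝔼 e, U (t + 1) (f t σ e) ^ 2) = v t + A t (fun σ => U t σ ^ 2) := by
      rw [← hAadd]
      congr 1
      funext σ
      rw [expect_sq_eq, ← hUt t ht]
    have h3 : A t (fun σ => var fun e => U (t + 1) (f t σ e) ^ 2) ≤ 4 * v t := by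
      rw [← hAmul]
      exact hAmono t _ _ fun σ => var_sq_le _ (fun e => hU0 _ _) fun e => hU1 _ _
    rw [h2] at h1
    have := (abs_le.1 h1).1
    linarith
  have hA01 : ∀ t, 0 ≤ A t (fun σ => U t σ ^ 2) ∧ A t (fun σ => U t σ ^ 2) ≤ 1 := by
    intro t
    refine ⟨?_, (hAmono t _ (fun _ => 1) fun σ => pow_le_one₀ (hU0 t σ) (hU1 t σ)).trans
      (hAone t).le⟩
    have := hAmul t 0 fun _ => 1
    have h0 := hAmono t (fun _ => 0 * 1) (fun σ => U t σ ^ 2) fun σ => by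
      rw [zero_mul]; exact sq_nonneg _
    linarith
  -- The energy `U ^ 2` stays in `[0, 1]`, so the sum of `v t / 2` is at most `1 + 2 * m * ε ≤ 3`.
  have hvsum : ∑ t ∈ range m, v t ≤ 6 := by
    have h1 := Finset.sum_le_sum fun t (ht : t ∈ range m) => hsecond t (mem_range.1 ht)
    rw [Finset.sum_range_sub (fun t => A t fun σ => U t σ ^ 2), Finset.sum_sub_distrib,
      ← Finset.sum_div] at h1
    simp only [Finset.sum_const, card_range, nsmul_eq_mul] at h1
    linarith [(hA01 0).1, (hA01 m).2]
  have htel : A m (U m) - A 0 (U 0) = ∑ t ∈ range m, (A (t + 1) (U (t + 1)) - A t (U t)) :=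
    (Finset.sum_range_sub (fun t => A t (U t)) m).symm
  have hAm : A m (U m) = A m h := by
    congr 1
    funext σ
    simp only [U, Nat.sub_self, valueToGo]
  have hA0 : A 0 (U 0) = 𝔼 e, h (runSteps f σ₀ m e) := by
    rw [expect_runSteps, hAzero]
    rfl
  rw [← hAh, ← hAm, ← hA0, htel]
  refine (Finset.abs_sum_le_sum_abs _ _).trans ((Finset.sum_le_sum fun t ht =>
    hfirst t (mem_range.1 ht)).trans ?_)
  rw [Finset.sum_add_distrib, ← Finset.sum_div]
  simp only [Finset.sum_const, card_range, nsmul_eq_mul]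
  have : (∑ t ∈ range m, v t) / (4 * l) ≤ 6 / (4 * l) := by gcongr
  have e : 6 / (4 * l) = 3 / (2 * l) := by field_simp; norm_num
  rw [e] at this
  linarith

end SequentialProcess

/-- A message of `s` bits about two random labellings carries little information about the sum of
the labels of a random pair. -/
lemma sum_info_le {k N : ℕ} [NeZero N] {S : Type} [Fintype S] (s : ℕ)
    (hS : Fintype.card S ≤ 2 ^ s)
    (g : S → (Fin N → Fin k → ZMod 2) × (Fin N → Fin k → ZMod 2) → ℝ)
    (hg0 : ∀ σ θ, 0 ≤ g σ θ) (hg1 : ∀ θ, ∑ σ, g σ θ = 1) :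
    ∑ σ, info (fun θ (c : Fin N × Fin N) => θ.1 c.1 + θ.2 c.2) (g σ) ≤
      2 ^ k * (2 * (12 * (s + 1)) ^ 2) / N ^ 2 := by
  have hN : (0 : ℝ) < N := by exact_mod_cast NeZero.pos N
  have h : ∀ σ, info (fun θ (c : Fin N × Fin N) => θ.1 c.1 + θ.2 c.2) (g σ) =
      ∑ r ∈ univ.erase ∅, ((∑ u, ∑ v, (𝔼 θ, g σ θ * (chi r (θ.1 u) * chi r (θ.2 v))) ^ 2) /
        𝔼 θ, g σ θ) / N ^ 2 := by
    intro σ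
    rw [info, Fintype.expect_eq_sum_div_card, Finset.sum_comm, ← Finset.sum_div,
      ← Finset.sum_div, div_right_comm]
    simp only [chi_add, Fintype.card_prod, Fintype.card_fin, Fintype.sum_prod_type]
    push_cast
    rw [sq]
  simp only [h]
  rw [Finset.sum_comm]
  simp only [← Finset.sum_div]
  gcongr
  refine (Finset.sum_le_card_nsmul _ _ (2 * (12 * ((s : ℝ) + 1)) ^ 2) fun r hr => ?_).trans ?_
  -- A character of `θ.1 u + θ.2 v` is a product of two signs, so each nontrivial character is one
  -- instance of the level-two inequality.
  · refine level_two (chi r) (chi_sq r) ?_ g hg0 hg1 s hS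
    rw [Fintype.expect_eq_sum_div_card,
      sum_chi r (Finset.nonempty_iff_ne_empty.2 (Finset.ne_of_mem_erase hr)), zero_div]
  · rw [nsmul_eq_mul]
    gcongr
    have : (univ.erase (∅ : Finset (Fin k))).card ≤ 2 ^ k := by
      refine (Finset.card_le_univ _).trans ?_
      simp
    exact_mod_cast this

lemma expect_fst {α β : Type} [Fintype α] [Fintype β] [Nonempty β] (φ : α → ℝ) :
    𝔼 x : α × β, φ x.1 = 𝔼 a, φ a := by
  rw [← Finset.univ_product_univ, Finset.expect_product]
  exact Finset.expect_congr rfl fun a _ => Fintype.expect_const (ι := β) (φ a)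

lemma expect_snd {α β : Type} [Fintype α] [Fintype β] [Nonempty α] (φ : β → ℝ) :
    𝔼 x : α × β, φ x.2 = 𝔼 b, φ b := by
  rw [← Finset.univ_product_univ, Finset.expect_product]
  exact Fintype.expect_const (ι := α) (𝔼 b, φ b)

/-! ### Lazy walks on the lift and expansion -/

section Walk

variable {N : ℕ} {G : Type} [AddCommGroup G]

/-- The exchange of the two endpoints of every edge of the lift of the edge `(u, v)` with
label `z`. -/
def swapFun (c : (Fin N × Fin N) × G) : (Fin N ⊕ Fin N) × G → (Fin N ⊕ Fin N) × G
  | (Sum.inl u, a) => if u = c.1.1 then (Sum.inr c.1.2, a + c.2) else (Sum.inl u, a)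
  | (Sum.inr v, b) => if v = c.1.2 then (Sum.inl c.1.1, b - c.2) else (Sum.inr v, b)

lemma swapFun_involutive (c : (Fin N × Fin N) × G) : Function.Involutive (swapFun c) := by
  rintro ⟨u | v, a⟩
  · by_cases h : u = c.1.1 <;> simp [swapFun, h]
  · by_cases h : v = c.1.2 <;> simp [swapFun, h]

/-- One step of the lazy walk. -/
def lazyStep (p : (Fin N ⊕ Fin N) × G) (x : ((Fin N × Fin N) × G) × Bool) :
    (Fin N ⊕ Fin N) × G :=
  if x.2 then swapFun x.1 p else p

lemma lazyStep_injective (x : ((Fin N × Fin N) × G) × Bool) :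
    Function.Injective fun p => lazyStep p x := by
  unfold lazyStep
  split_ifs
  · exact (swapFun_involutive x.1).injective
  · exact fun _ _ h => h

/-- The position after `t` steps of the walk started at `y`. -/
def walk {t : ℕ} (e : Fin t → (Fin N × Fin N) × G) (W : Fin t → Bool)
    (y : (Fin N ⊕ Fin N) × G) : (Fin N ⊕ Fin N) × G :=
  runSteps (fun _ => lazyStep) y t fun i => (e i, W i)

lemma walk_snoc {t : ℕ} (e : Fin t → (Fin N × Fin N) × G) (W : Fin t → Bool) (c) (b : Bool)
    (y : (Fin N ⊕ Fin N) × G) :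
    walk (Fin.snoc e c : Fin (t + 1) → _) (Fin.snoc W b : Fin (t + 1) → Bool) y =
      lazyStep (walk e W y) (c, b) := by
  simp only [walk, runSteps, Fin.snoc_last]
  congr 2
  funext i
  simp [Fin.init]

lemma walk_injective {t : ℕ} (e : Fin t → (Fin N × Fin N) × G) (W : Fin t → Bool) :
    Function.Injective (walk e W) := by
  induction t with
  | zero => exact fun _ _ h => h
  | succ t ih =>
    intro y y' h
    rw [← Fin.snoc_init_self e, ← Fin.snoc_init_self W, walk_snoc, walk_snoc] at h
    exact ih _ _ (lazyStep_injective _ h)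

variable [Fintype G]

lemma expect_bool (F : Bool → ℝ) : 𝔼 b, F b = (F true + F false) / 2 := by
  rw [Fintype.expect_eq_sum_div_card]; simp

/-- A point stays fixed unless the random edge meets its base vertex, which has probability `1 / N`.
It moves to a given other point for at most one of the `N ^ 2 * |G|` labelled edges. -/
lemma expect_swapFun_eq_le [DecidableEq G] [NeZero N] (p p' : (Fin N ⊕ Fin N) × G) :
    𝔼 c : (Fin N × Fin N) × G, (if swapFun c p = p' then (1 : ℝ) else 0) ≤
      (1 - 1 / N) * (if p = p' then 1 else 0) + 1 / (N ^ 2 * Fintype.card G) := by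
  have hN : (0 : ℝ) < N := by exact_mod_cast NeZero.pos N
  have hG : (0 : ℝ) < Fintype.card G := by exact_mod_cast Fintype.card_pos
  split_ifs with h
  · subst h
    have hmarg : ∀ w : Fin N,
        𝔼 c : (Fin N × Fin N) × G, (if c.1.1 = w then (1 : ℝ) else 0) = 1 / N ∧
        𝔼 c : (Fin N × Fin N) × G, (if c.1.2 = w then (1 : ℝ) else 0) = 1 / N := by
      intro w
      rw [expect_fst fun x : Fin N × Fin N => if x.1 = w then (1 : ℝ) else 0,
        expect_fst fun u => if u = w then (1 : ℝ) else 0,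
        expect_fst fun x : Fin N × Fin N => if x.2 = w then (1 : ℝ) else 0,
        expect_snd fun u => if u = w then (1 : ℝ) else 0]
      simp
    have hsub : ∀ ψ : (Fin N × Fin N) × G → ℝ, 𝔼 c, ψ c = 1 / N →
        (∀ c, (if swapFun c p = p then (1 : ℝ) else 0) ≤ 1 - ψ c) →
        𝔼 c : (Fin N × Fin N) × G, (if swapFun c p = p then (1 : ℝ) else 0) ≤ 1 - 1 / N := by
      intro ψ hψ hc
      refine (Finset.expect_le_expect fun c _ => hc c).trans ?_
      rw [Finset.expect_sub_distrib, hψ, Fintype.expect_const]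
    have hpos : 0 ≤ 1 / ((N : ℝ) ^ 2 * Fintype.card G) := by positivity
    refine le_trans ?_ (le_add_of_nonneg_right hpos)
    rw [mul_one]
    obtain ⟨u | v, a⟩ := p
    · refine hsub _ (hmarg u).1 fun c => ?_
      by_cases hu : c.1.1 = u
      · simp [swapFun, hu]
      · split_ifs <;> norm_num
    · refine hsub _ (hmarg v).2 fun c => ?_
      by_cases hu : c.1.2 = v
      · simp [swapFun, hu]
      · split_ifs <;> norm_num
  · have hex : ∃ c₀ : (Fin N × Fin N) × G, ∀ c, swapFun c p = p' → c = c₀ := by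
      obtain ⟨u | v, a⟩ := p <;> obtain ⟨u' | v', b⟩ := p'
      · refine ⟨((0, 0), 0), fun c hc => ?_⟩
        by_cases hu : u = c.1.1
        · simp [swapFun, hu] at hc
        · exact absurd (by simpa [swapFun, hu] using hc) h
      · refine ⟨((u, v'), b - a), fun c hc => ?_⟩
        by_cases hu : u = c.1.1
        · simp only [swapFun, hu, if_true, Prod.mk.injEq, Sum.inr.injEq] at hc
          obtain ⟨⟨c1, c2⟩, c3⟩ := c
          simp only at hc hu
          rw [hu, ← hc.1, ← hc.2]; simp
        · simp [swapFun, hu] at hc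
      · refine ⟨((u', v), a - b), fun c hc => ?_⟩
        by_cases hu : v = c.1.2
        · simp only [swapFun, hu, if_true, Prod.mk.injEq, Sum.inl.injEq] at hc
          obtain ⟨⟨c1, c2⟩, c3⟩ := c
          simp only at hc hu
          rw [hu, ← hc.1, ← hc.2]; simp
        · simp [swapFun, hu] at hc
      · refine ⟨((0, 0), 0), fun c hc => ?_⟩
        by_cases hu : v = c.1.2
        · simp [swapFun, hu] at hc
        · exact absurd (by simpa [swapFun, hu] using hc) h
    obtain ⟨c₀, hc₀⟩ := hex
    have h1 : 𝔼 c : (Fin N × Fin N) × G, (if swapFun c p = p' then (1 : ℝ) else 0) ≤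
        𝔼 c : (Fin N × Fin N) × G, if c = c₀ then (1 : ℝ) else 0 := by
      refine Finset.expect_le_expect fun c _ => ?_
      by_cases hc : swapFun c p = p'
      · rw [if_pos hc, if_pos (hc₀ c hc)]
      · rw [if_neg hc]; split_ifs <;> norm_num
    refine h1.trans (le_of_eq ?_)
    rw [Fintype.expect_eq_sum_div_card]
    simp
    ring

/-- Both walks see the same edge but use independent coins. Equal coins preserve equality and
inequality of the positions, because the swap is injective; unequal coins make one walk move while
the other waits. -/
lemma expect_lazyStep_eq_le [DecidableEq G] [NeZero N] (p p' : (Fin N ⊕ Fin N) × G) :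
    𝔼 c : (Fin N × Fin N) × G, 𝔼 b : Bool, 𝔼 b' : Bool,
      (if lazyStep p (c, b) = lazyStep p' (c, b') then (1 : ℝ) else 0) ≤
      (1 - 1 / (2 * N)) * (if p = p' then 1 else 0) + 1 / (2 * N ^ 2 * Fintype.card G) := by
  have hN : (0 : ℝ) < N := by exact_mod_cast NeZero.pos N
  have hG : (0 : ℝ) < Fintype.card G := by exact_mod_cast Fintype.card_pos
  have h1 := expect_swapFun_eq_le p p'
  have h2 := expect_swapFun_eq_le p' p
  have e : ∀ c : (Fin N × Fin N) × G, 𝔼 b : Bool, 𝔼 b' : Bool,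
      (if lazyStep p (c, b) = lazyStep p' (c, b') then (1 : ℝ) else 0) =
      (1 / 2) * (if p = p' then 1 else 0) + (1 / 4) * (if swapFun c p = p' then 1 else 0) +
        (1 / 4) * (if swapFun c p' = p then 1 else 0) := by
    intro c
    simp only [expect_bool, lazyStep, if_true, Bool.false_eq_true, if_false,
      (swapFun_involutive c).injective.eq_iff, eq_comm (a := p) (b := swapFun c p')]
    ring
  simp only [e, Finset.expect_add_distrib, ← Finset.mul_expect, Fintype.expect_const]
  have hcomm : (if p' = p then (1 : ℝ) else 0) = if p = p' then 1 else 0 := by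
    simp only [eq_comm]
  rw [hcomm] at h2
  have e1 : 1 / (2 * (N : ℝ)) = (1 / 2) * (1 / N) := by field_simp
  have e2 : 1 / (2 * (N : ℝ) ^ 2 * Fintype.card G) = (1 / 2) * (1 / (N ^ 2 * Fintype.card G)) := by
    field_simp
  rw [e1, e2]
  linarith

/-- The number of starting points, weighted with the probability that two independent walks
from there meet at the end. -/
def meetings [DecidableEq G] {t : ℕ} (e : Fin t → (Fin N × Fin N) × G) : ℝ :=
  ∑ y, 𝔼 W, 𝔼 W', if walk e W y = walk e W' y then (1 : ℝ) else 0

lemma meetings_nonneg [DecidableEq G] {t : ℕ} (e : Fin t → (Fin N × Fin N) × G) : 0 ≤ meetings e :=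
  Finset.sum_nonneg fun y _ => Finset.expect_nonneg fun W _ => Finset.expect_nonneg fun W' _ => by
    split_ifs <;> norm_num

/-- The step bound is an affine recursion with contraction factor `1 - 1 / (2 * N)` and fixed point
`1 / (N * |G|)`, which is twice the inverse of the number of points. -/
lemma expect_meet_le [DecidableEq G] [NeZero N] (t : ℕ) (y : (Fin N ⊕ Fin N) × G) :
    𝔼 e : Fin t → (Fin N × Fin N) × G, 𝔼 W, 𝔼 W',
      (if walk e W y = walk e W' y then (1 : ℝ) else 0) ≤
      (1 - 1 / (2 * N)) ^ t + 1 / (N * Fintype.card G) := by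
  have hN : (1 : ℝ) ≤ N := by exact_mod_cast NeZero.pos N
  have hG : (0 : ℝ) < Fintype.card G := by exact_mod_cast Fintype.card_pos
  have hN2 : 0 ≤ 1 - 1 / (2 * (N : ℝ)) := by
    rw [sub_nonneg, div_le_one (by positivity)]; linarith
  induction t with
  | zero =>
    simp [walk, runSteps]
    positivity
  | succ t ih =>
    rw [expect_snoc]
    have hstep : ∀ e : Fin t → (Fin N × Fin N) × G,
        𝔼 c, 𝔼 W : Fin (t + 1) → Bool, 𝔼 W' : Fin (t + 1) → Bool,
          (if walk (Fin.snoc e c : Fin (t + 1) → _) W y =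
            walk (Fin.snoc e c : Fin (t + 1) → _) W' y then (1 : ℝ) else 0) ≤
        (1 - 1 / (2 * N)) * (𝔼 W, 𝔼 W', if walk e W y = walk e W' y then (1 : ℝ) else 0) +
          1 / (2 * N ^ 2 * Fintype.card G) := by
      intro e
      have e1 : 𝔼 c, 𝔼 W : Fin (t + 1) → Bool, 𝔼 W' : Fin (t + 1) → Bool,
          (if walk (Fin.snoc e c : Fin (t + 1) → _) W y =
            walk (Fin.snoc e c : Fin (t + 1) → _) W' y then (1 : ℝ) else 0) =
          𝔼 W, 𝔼 W', 𝔼 c, 𝔼 b, 𝔼 b', if lazyStep (walk e W y) (c, b) =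
            lazyStep (walk e W' y) (c, b') then (1 : ℝ) else 0 := by
        simp only [expect_snoc, walk_snoc]
        rw [Finset.expect_comm]
        refine Finset.expect_congr rfl fun W _ => ?_
        rw [Finset.expect_comm]
        conv_rhs => rw [Finset.expect_comm]
        have : ∀ c, (𝔼 b : Bool, 𝔼 W' : Fin t → Bool, 𝔼 b', if lazyStep (walk e W y) (c, b) =
            lazyStep (walk e W' y) (c, b') then (1 : ℝ) else 0) =
            𝔼 W' : Fin t → Bool, 𝔼 b : Bool, 𝔼 b', if lazyStep (walk e W y) (c, b) =
            lazyStep (walk e W' y) (c, b') then (1 : ℝ) else 0 := fun c =>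
          Finset.expect_comm _ _ _
        simp only [← this]
        exact Finset.expect_comm _ _ _
      rw [e1]
      refine (Finset.expect_le_expect fun W _ => Finset.expect_le_expect fun W' _ =>
        expect_lazyStep_eq_le _ _).trans (le_of_eq ?_)
      simp only [Finset.expect_add_distrib, ← Finset.mul_expect, Fintype.expect_const]
    refine (Finset.expect_le_expect fun e _ => hstep e).trans ?_
    rw [Finset.expect_add_distrib, ← Finset.mul_expect, Fintype.expect_const]
    refine (add_le_add_left (mul_le_mul_of_nonneg_left ih hN2) _).trans (le_of_eq ?_)
    rw [pow_succ (1 - 1 / (2 * (N : ℝ))) t]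
    generalize (1 - 1 / (2 * (N : ℝ))) ^ t = P
    field_simp
    ring

lemma expect_meetings_le [DecidableEq G] [NeZero N] (t : ℕ) :
    𝔼 e : Fin t → (Fin N × Fin N) × G, meetings e ≤
      2 * N * Fintype.card G * ((1 - 1 / (2 * N)) ^ t + 1 / (N * Fintype.card G)) := by
  unfold meetings
  rw [Finset.expect_sum_comm]
  refine (Finset.sum_le_card_nsmul _ _ _ fun y _ => expect_meet_le t y).trans (le_of_eq ?_)
  rw [nsmul_eq_mul]
  congr 1
  simp
  ring

variable {κ : Type} [DecidableEq κ]

/-- The number of bichromatic edges of the lift. -/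
def crossings {t : ℕ} (e : Fin t → (Fin N × Fin N) × G) (f : (Fin N ⊕ Fin N) × G → κ) : ℝ :=
  ∑ i, ∑ a, if f (Sum.inl (e i).1.1, a) = f (Sum.inr (e i).1.2, a + (e i).2) then 0 else 1

lemma sum_swapFun (c : (Fin N × Fin N) × G) (f : (Fin N ⊕ Fin N) × G → κ) :
    ∑ p, (if f p = f (swapFun c p) then (0 : ℝ) else 1) =
      2 * ∑ a, if f (Sum.inl c.1.1, a) = f (Sum.inr c.1.2, a + c.2) then 0 else 1 := by
  rw [Fintype.sum_prod_type, Fintype.sum_sum_type, two_mul]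
  congr 1
  · rw [Finset.sum_eq_single c.1.1]
    · simp [swapFun]
    · intro u _ hu; simp [swapFun, hu]
    · simp
  · rw [Finset.sum_eq_single c.1.2]
    · rw [← Equiv.sum_comp (Equiv.addRight c.2)]
      refine Finset.sum_congr rfl fun a _ => ?_
      simp [swapFun, eq_comm]
    · intro u _ hu; simp [swapFun, hu]
    · simp

/-- For fixed coins the walk permutes the points. Hence at each step every bichromatic edge above
the current base edge is met by exactly two starting points, and each crosses with probability one
half. -/
lemma expect_walk_ne_le {t : ℕ} (e : Fin t → (Fin N × Fin N) × G)
    (f : (Fin N ⊕ Fin N) × G → κ) :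
    𝔼 W, ∑ y, (if f y = f (walk e W y) then (0 : ℝ) else 1) ≤ crossings e f := by
  induction t with
  | zero => simp [walk, runSteps, crossings]
  | succ t ih =>
    obtain ⟨e', c, rfl⟩ : ∃ (e' : Fin t → (Fin N × Fin N) × G) (c : (Fin N × Fin N) × G),
      e = (Fin.snoc e' c : Fin (t + 1) → _) := ⟨Fin.init e, e (Fin.last t), by simp⟩
    rw [expect_snoc]
    simp only [walk_snoc]
    have hcr : crossings (Fin.snoc e' c : Fin (t + 1) → _) f = crossings e' f +
        ∑ a, if f (Sum.inl c.1.1, a) = f (Sum.inr c.1.2, a + c.2) then 0 else 1 := by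
      unfold crossings
      rw [Fin.sum_univ_castSucc]
      simp
    rw [hcr]
    have hW : ∀ W : Fin t → Bool, 𝔼 b, ∑ y,
        (if f y = f (lazyStep (walk e' W y) (c, b)) then (0 : ℝ) else 1) ≤
        ∑ y, (if f y = f (walk e' W y) then (0 : ℝ) else 1) +
          ∑ a, if f (Sum.inl c.1.1, a) = f (Sum.inr c.1.2, a + c.2) then 0 else 1 := by
      intro W
      have hbij : Function.Bijective (walk e' W) :=
        Finite.injective_iff_bijective.1 (walk_injective e' W)
      have h1 : ∑ y, (if f y = f (swapFun c (walk e' W y)) then (0 : ℝ) else 1) ≤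
          ∑ y, (if f y = f (walk e' W y) then (0 : ℝ) else 1) +
            ∑ p, (if f p = f (swapFun c p) then (0 : ℝ) else 1) := by
        rw [← Function.Bijective.sum_comp hbij fun p =>
          (if f p = f (swapFun c p) then (0 : ℝ) else 1), ← Finset.sum_add_distrib]
        refine Finset.sum_le_sum fun y _ => ?_
        by_cases ha : f y = f (walk e' W y)
        · rw [← ha]; simp
        · rw [if_neg ha]
          split_ifs <;> norm_num
      rw [sum_swapFun] at h1
      rw [expect_bool]
      simp only [lazyStep, if_true, Bool.false_eq_true, if_false]
      linarith
    refine (Finset.expect_le_expect fun W _ => hW W).trans ?_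
    rw [Finset.expect_add_distrib, Fintype.expect_const]
    exact add_le_add_left (ih e') _

/-- Cauchy–Schwarz over pairs of points: at most `2 * N * |G| * K` pairs are monochromatic, and the
squared transition probabilities sum to `meetings e`. -/
lemma sq_expect_walk_eq_le [DecidableEq G] {t : ℕ} (e : Fin t → (Fin N × Fin N) × G)
    (f : (Fin N ⊕ Fin N) × G → κ) (K : ℕ) (hK : ∀ c, #{y | f y = c} ≤ K) :
    (𝔼 W, ∑ y, (if f y = f (walk e W y) then (1 : ℝ) else 0)) ^ 2 ≤
      2 * N * Fintype.card G * K * meetings e := by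
  let A : (Fin N ⊕ Fin N) × G → (Fin N ⊕ Fin N) × G → ℝ := fun y w =>
    𝔼 W, if walk e W y = w then (1 : ℝ) else 0
  have h1 : 𝔼 W, ∑ y, (if f y = f (walk e W y) then (1 : ℝ) else 0) =
      ∑ x : ((Fin N ⊕ Fin N) × G) × ((Fin N ⊕ Fin N) × G),
        (if f x.1 = f x.2 then (1 : ℝ) else 0) * A x.1 x.2 := by
    rw [Fintype.sum_prod_type, Finset.expect_sum_comm]
    refine Finset.sum_congr rfl fun y _ => ?_
    simp only [A, Finset.mul_expect]
    rw [← Finset.expect_sum_comm]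
    refine Finset.expect_congr rfl fun W _ => ?_
    simp
  have h2 : meetings e =
      ∑ x : ((Fin N ⊕ Fin N) × G) × ((Fin N ⊕ Fin N) × G), A x.1 x.2 ^ 2 := by
    rw [Fintype.sum_prod_type]
    refine Finset.sum_congr rfl fun y _ => ?_
    simp only [A, sq, Finset.expect_mul_expect]
    rw [← Finset.expect_sum_comm]
    refine Finset.expect_congr rfl fun W _ => ?_
    rw [← Finset.expect_sum_comm]
    refine Finset.expect_congr rfl fun W' _ => ?_
    simp [eq_comm]
  have h3 : ∑ x : ((Fin N ⊕ Fin N) × G) × ((Fin N ⊕ Fin N) × G),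
      (if f x.1 = f x.2 then (1 : ℝ) else 0) ^ 2 ≤ 2 * N * Fintype.card G * K := by
    rw [Fintype.sum_prod_type]
    refine (Finset.sum_le_card_nsmul _ _ (K : ℝ) fun y _ => ?_).trans (le_of_eq ?_)
    · have : ∑ w, (if f y = f w then (1 : ℝ) else 0) ^ 2 = #{w | f w = f y} := by
        simp [eq_comm]
      rw [this]
      exact_mod_cast hK (f y)
    · rw [nsmul_eq_mul]
      congr 1
      simp
      ring
  rw [h1, h2]
  refine (Finset.sum_mul_sq_le_sq_mul_sq _ _ _).trans ?_
  exact mul_le_mul_of_nonneg_right h3 (Finset.sum_nonneg fun _ _ => sq_nonneg _)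

/-- If independent walks rarely meet, then a colouring with small classes has many bichromatic
edges. -/
lemma le_crossings [DecidableEq G] {t : ℕ} (e : Fin t → (Fin N × Fin N) × G)
    (f : (Fin N ⊕ Fin N) × G → κ) (K : ℕ) (hK : ∀ c, #{y | f y = c} ≤ K)
    (h : 2 * K * meetings e ≤ N * Fintype.card G) :
    (N : ℝ) * Fintype.card G ≤ crossings e f := by
  have h1 := expect_walk_ne_le e f
  have h2 := sq_expect_walk_eq_le e f K hK
  have h3 : 𝔼 W, ∑ y, (if f y = f (walk e W y) then (0 : ℝ) else 1) =
      2 * (N * Fintype.card G) -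
        𝔼 W, ∑ y, (if f y = f (walk e W y) then (1 : ℝ) else 0) := by
    have : ∀ W, ∑ y, (if f y = f (walk e W y) then (0 : ℝ) else 1) =
        2 * (N * Fintype.card G) - ∑ y, (if f y = f (walk e W y) then (1 : ℝ) else 0) := by
      intro W
      have hc : (2 * (N * Fintype.card G) : ℝ) = ∑ y : (Fin N ⊕ Fin N) × G, (1 : ℝ) := by
        simp; ring
      rw [hc, ← Finset.sum_sub_distrib]
      exact Finset.sum_congr rfl fun y _ => by split_ifs <;> norm_num
    simp only [this, Finset.expect_sub_distrib, Fintype.expect_const]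
  have hb : (0 : ℝ) ≤ N * Fintype.card G := by positivity
  have h4 : 𝔼 W, ∑ y, (if f y = f (walk e W y) then (1 : ℝ) else 0) ≤ N * Fintype.card G := by
    refine abs_le_of_sq_le_sq' ?_ hb |>.2
    refine h2.trans ?_
    nlinarith
  linarith

end Walk

/-- The common block length fixes the value of the edge counter at the start of block `j`, whatever
the earlier blocks contain. A whole block therefore acts as one step of a time-dependent process. -/
lemma foldl_flatten_ofFn {α S E : Type} (g : S → α × ℕ → S) (L : ℕ) (σ₀ : S)
    (B : ℕ → E → List α) (hL : ∀ j c, (B j c).length = L) (t : ℕ) (e : Fin t → E) :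
    (List.ofFn fun i : Fin t => B i (e i)).flatten.zipIdx.foldl g σ₀ =
      runSteps (fun j σ c => ((B j c).zipIdx (j * L)).foldl g σ) σ₀ t e := by
  induction t with
  | zero => simp [runSteps]
  | succ t ih =>
    have hlen : (List.ofFn fun i : Fin t => B i (e i.castSucc)).flatten.length = t * L := by
      simp [List.length_flatten, List.map_ofFn, Function.comp_def, hL]
    rw [List.ofFn_succ', List.concat_eq_append, List.flatten_append, List.zipIdx_append,
      List.foldl_append, runSteps]
    simp only [Fin.val_castSucc, Fin.val_last, List.flatten_cons, List.flatten_nil,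
      List.append_nil, hlen, zero_add]
    rw [ih fun i => e i.castSucc]
    rfl

/-! ### The lift, its stream, and its optimal value -/

section Lift

variable {N m k n : ℕ}

/-- The vertices of the lift: a copy of `(ZMod 2) ^ k` for every vertex of the base graph and for
the midpoint of every edge of the base graph. -/
abbrev LiftVertex (N m k : ℕ) : Type :=
  ((Fin N ⊕ Fin N) × (Fin k → ZMod 2)) ⊕ (Fin m × (Fin k → ZMod 2))

/-- An edge of the base graph with its label. -/
abbrev LabelledEdge (N k : ℕ) : Type := (Fin N × Fin N) × (Fin k → ZMod 2)

variable (ι : LiftVertex N m k ↪ Fin n)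

/-- The two halves of the edges above the `i`-th edge of the base graph. -/
def halfEdge (i : Fin m) (c : LabelledEdge N k) (x : (Fin k → ZMod 2) × Bool) : Sym2 (Fin n) :=
  s(ι (Sum.inr (i, x.1)),
    ι (Sum.inl (if x.2 then (Sum.inl c.1.1, x.1) else (Sum.inr c.1.2, x.1 + c.2))))

/-- Every half-edge contains exactly one midpoint, which reveals the index and the sheet; the side
of the other endpoint reveals the bit. So repeated base edges never give repeated edges of the lift.
-/
lemma halfEdge_injective (i j : Fin m) (c d : LabelledEdge N k) (hcd : i = j → c = d)
    (x y : (Fin k → ZMod 2) × Bool) (h : halfEdge ι i c x = halfEdge ι j d y) :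
    i = j ∧ x = y := by
  obtain ⟨a, b⟩ := x
  obtain ⟨a', b'⟩ := y
  unfold halfEdge at h
  rw [Sym2.eq_iff] at h
  simp only [EmbeddingLike.apply_eq_iff_eq, reduceCtorEq, and_self, or_false, Sum.inr.injEq,
    Sum.inl.injEq, Prod.mk.injEq] at h
  obtain ⟨⟨rfl, rfl⟩, h2⟩ := h
  refine ⟨rfl, ?_⟩
  cases b <;> cases b' <;> simp_all

/-- The part of the stream that belongs to the `i`-th edge of the base graph. -/
def block (i : Fin m) (c : LabelledEdge N k) : List (Sym2 (Fin n)) :=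
  (univ : Finset ((Fin k → ZMod 2) × Bool)).toList.map (halfEdge ι i c)

/-- The stream of the edges of the lift. -/
def stream (e : Fin m → LabelledEdge N k) : List (Sym2 (Fin n)) :=
  (List.ofFn fun i => block ι i (e i)).flatten

lemma length_block (i : Fin m) (c : LabelledEdge N k) :
    (block ι i c).length = 2 ^ k * 2 := by
  simp [block]

lemma mem_stream (e : Fin m → LabelledEdge N k) (x : Sym2 (Fin n)) :
    x ∈ stream ι e ↔ ∃ i y, halfEdge ι i (e i) y = x := by
  simp [stream, block, List.mem_flatten, List.mem_ofFn]

lemma nodup_stream (e : Fin m → LabelledEdge N k) : (stream ι e).Nodup := by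
  rw [stream, List.nodup_flatten]
  constructor
  · intro l hl
    obtain ⟨i, rfl⟩ := List.mem_ofFn.1 hl
    refine List.Nodup.map_on ?_ (Finset.nodup_toList _)
    exact fun x _ y _ h => (halfEdge_injective ι i i _ _ (fun _ => rfl) x y h).2
  · rw [List.pairwise_ofFn]
    intro i j hij
    rw [List.disjoint_left]
    intro x hx hy
    obtain ⟨a, -, ha⟩ := List.mem_map.1 hx
    obtain ⟨b, -, hb⟩ := List.mem_map.1 hy
    exact hij.ne (halfEdge_injective ι i j _ _ (fun h => absurd h hij.ne) a b (ha.trans hb.symm)).1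

lemma length_stream (e : Fin m → LabelledEdge N k) :
    (stream ι e).length = m * (2 ^ k * 2) := by
  simp [stream, List.length_flatten, List.map_ofFn, Function.comp_def, length_block]

/-- The lift of a labelled base graph. -/
def liftGraph (e : Fin m → LabelledEdge N k) : SimpleGraph (Fin n) :=
  SimpleGraph.fromEdgeSet {x | x ∈ stream ι e}

lemma mem_stream_iff (e : Fin m → LabelledEdge N k) (x : Sym2 (Fin n)) :
    x ∈ stream ι e ↔ x ∈ (liftGraph ι e).edgeSet := by
  rw [liftGraph, SimpleGraph.edgeSet_fromEdgeSet]
  refine ⟨fun h => ⟨h, ?_⟩, fun h => h.1⟩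
  obtain ⟨i, y, rfl⟩ := (mem_stream ι e x).1 h
  simp [halfEdge]

lemma isStreamOf_liftGraph (e : Fin m → LabelledEdge N k) :
    IsStreamOf (stream ι e) (liftGraph ι e) :=
  ⟨nodup_stream ι e, mem_stream_iff ι e⟩

/-- The sequence of base edges `c` with the labels induced by the potentials `θ`. -/
def induced (θ : (Fin N → Fin k → ZMod 2) × (Fin N → Fin k → ZMod 2))
    (c : Fin m → Fin N × Fin N) : Fin m → LabelledEdge N k :=
  fun i => (c i, θ.1 (c i).1 + θ.2 (c i).2)

/-- If the labels are induced by potentials, then the lift falls apart into small pieces. -/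
lemma opt_liftGraph_induced_le [NeZero n] (θ : (Fin N → Fin k → ZMod 2) × (Fin N → Fin k → ZMod 2))
    (c : Fin m → Fin N × Fin N) :
    opt (liftGraph ι (induced θ c)) (fun _ => 1) ≤ m * (2 ^ k * 2) * (2 * N + m) := by
  classical
  -- Adding the potential to the sheet gives a quantity that is constant along edges, since `θ.2 +
  -- θ.2 = 0`; midpoints take over the potential of their left endpoint.
  let sh : (Fin N ⊕ Fin N) ⊕ Fin m → (Fin k → ZMod 2) :=
    Sum.elim (Sum.elim θ.1 θ.2) fun i => θ.1 (c i).1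
  let lab : LiftVertex N m k → (Fin k → ZMod 2) :=
    Sum.elim (fun p => p.2 + sh (Sum.inl p.1)) fun p => p.2 + sh (Sum.inr p.1)
  -- The vertices outside the lift share the colour `none`. Their class may be large, but it
  -- contains no edge and so costs nothing.
  let f : Fin n → Option (Fin k → ZMod 2) :=
    Function.extend ι (fun p => some (lab p)) fun _ => none
  have hf : ∀ p, f (ι p) = some (lab p) := fun p => ι.injective.extend_apply _ _ p
  have hf' : ∀ w g, f w = some g → ∃ p, ι p = w ∧ lab p = g := by
    intro w g h
    by_cases hw : ∃ p, ι p = w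
    · obtain ⟨p, rfl⟩ := hw
      exact ⟨p, rfl, by simpa [hf] using h⟩
    · simp [f, Function.extend_apply' _ _ _ hw] at h
  have hclass : ∀ g, #{w | f w = some g} ≤ 2 * N + m := by
    intro g
    have hsub : ({w | f w = some g} : Finset (Fin n)) ⊆
        (univ : Finset ((Fin N ⊕ Fin N) ⊕ Fin m)).image fun b =>
          ι (Sum.map (fun p => (p, g - sh b)) (fun i => (i, g - sh b)) b) := by
      intro w hw
      obtain ⟨p, rfl, rfl⟩ := hf' w g (by simpa using hw)
      rw [mem_image]
      obtain ⟨p, a⟩ | ⟨i, a⟩ := p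
      · exact ⟨Sum.inl p, mem_univ _, by simp [lab]⟩
      · exact ⟨Sum.inr i, mem_univ _, by simp [lab]⟩
    refine (Finset.card_le_card hsub).trans (Finset.card_image_le.trans ?_)
    simp [two_mul]
  have hedge : ∀ (i : Fin m) (x : (Fin k → ZMod 2) × Bool), lab (Sum.inr (i, x.1)) = lab (Sum.inl (if x.2 then (Sum.inl (c i).1, x.1)
      else (Sum.inr (c i).2, x.1 + (θ.1 (c i).1 + θ.2 (c i).2)))) := by
    rintro i ⟨a, b⟩
    cases b
    · have h2 : θ.2 (c i).2 + θ.2 (c i).2 = 0 := by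
        funext j; exact CharTwo.add_self_eq_zero _
      simp [lab, sh, add_assoc, h2]
    · simp [lab, sh]
  have h := opt_le_of_coloring (liftGraph ι (induced θ c)) (stream ι (induced θ c)).toFinset
    (fun x => by rw [List.mem_toFinset]; exact mem_stream_iff ι _ x) f (2 * N + m) ?_
  · rw [List.toFinset_card_of_nodup (nodup_stream ι _), length_stream] at h
    exact_mod_cast h
  · intro u v huv
    rw [List.mem_toFinset, mem_stream] at huv
    obtain ⟨i, x, hx⟩ := huv
    have heq := hedge i x
    unfold halfEdge at hx
    rw [Sym2.eq_iff] at hx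
    rcases hx with ⟨rfl, rfl⟩ | ⟨rfl, rfl⟩
    · rw [hf, hf]
      exact ⟨congrArg some heq, hclass _⟩
    · rw [hf, hf]
      exact ⟨congrArg some heq.symm, hclass _⟩

/-- If independent walks in the base graph rarely meet, then the lift has no cheap clustering. -/
lemma le_opt_liftGraph [NeZero n] (e : Fin m → LabelledEdge N k) (K : ℕ) (hK : 1 ≤ K)
    (h : 2 * K * meetings e ≤ N * 2 ^ k) :
    (K : ℝ) * (N * 2 ^ k) ≤ opt (liftGraph ι e) (fun _ => 1) := by
  classical
  refine le_opt_of_coloring (liftGraph ι e) (stream ι e).toFinset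
    (fun x => by rw [List.mem_toFinset]; exact mem_stream_iff ι _ x) K hK _ fun f hf => ?_
  let f' : (Fin N ⊕ Fin N) × (Fin k → ZMod 2) → List ℕ := fun p => f (ι (Sum.inl p))
  have hf' : ∀ c, #{p | f' p = c} ≤ K := by
    intro c
    refine le_trans (Finset.card_le_card_of_injOn (fun p => ι (Sum.inl p)) ?_ ?_) (hf c)
    · intro p hp; simpa [f'] using hp
    · intro p _ q _ hpq; simpa using hpq
  have hcard : (Fintype.card (Fin k → ZMod 2) : ℝ) = 2 ^ k := by simp [ZMod.card]
  have hcr := le_crossings e f' K hf' (by rwa [hcard])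
  rw [hcard] at hcr
  refine ⟨(stream ι e).toFinset.filter fun x => ¬ (x.map f).IsDiag, filter_subset _ _, ?_, ?_⟩
  · intro u v huv
    simpa using (mem_filter.1 huv).2
  · refine hcr.trans ?_
    have hc : crossings e f' = #{x : Fin m × (Fin k → ZMod 2) |
        f' (Sum.inl (e x.1).1.1, x.2) ≠ f' (Sum.inr (e x.1).1.2, x.2 + (e x.1).2)} := by
      rw [crossings, ← Fintype.sum_prod_type', Finset.card_filter]
      push_cast
      exact Finset.sum_congr rfl fun x _ => by split_ifs <;> simp_all
    rw [hc]
    norm_cast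
    -- If the two ends of a subdivided edge have different colours, one of its halves is
    -- bichromatic; `b` selects such a half.
    let b : Fin m × (Fin k → ZMod 2) → Bool := fun x =>
      decide (f (ι (Sum.inr x)) ≠ f' (Sum.inl (e x.1).1.1, x.2))
    refine Finset.card_le_card_of_injOn (fun x => halfEdge ι x.1 (e x.1) (x.2, b x)) ?_ ?_
    · intro x hx
      have hx' : f' (Sum.inl (e x.1).1.1, x.2) ≠ f' (Sum.inr (e x.1).1.2, x.2 + (e x.1).2) := by
        simpa using hx
      simp only [coe_filter, List.mem_toFinset, Set.mem_ofPred_eq, mem_stream]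
      refine ⟨⟨_, _, rfl⟩, ?_⟩
      simp only [halfEdge, Sym2.map_mk, Sym2.mk_isDiag_iff]
      by_cases hb : f (ι (Sum.inr x)) = f' (Sum.inl (e x.1).1.1, x.2)
      · have : b x = false := by simp [b, hb]
        rw [this]
        simp only [Bool.false_eq_true, if_false]
        intro h
        exact hx' (hb.symm.trans h)
      · have : b x = true := by simp [b, hb]
        rw [this]
        exact hb
    · rintro ⟨i, a⟩ _ ⟨j, a'⟩ _ hxy
      obtain ⟨h1, h2⟩ := halfEdge_injective ι i j _ _ (fun h => by rw [h]) _ _ hxy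
      simp only [Prod.mk.injEq] at h2
      rw [h1, h2.1]

/-- A process with `s` bits of memory hardly distinguishes induced from uniform labels. -/
lemma abs_expect_runSteps_induced_sub_le [NeZero N] {S : Type} [Fintype S] (s : ℕ)
    (hS : Fintype.card S ≤ 2 ^ s) (f : ℕ → S → LabelledEdge N k → S) (σ₀ : S) (h : S → ℝ)
    (hh : ∀ σ, 0 ≤ h σ ∧ h σ ≤ 1) (l : ℝ) (hl : 0 < l)
    (hε : m * (2 ^ k * (2 * (12 * ((s : ℝ) + 1)) ^ 2) / (N : ℝ) ^ 2) ≤ 1) :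
    |(𝔼 θ, 𝔼 c : Fin m → Fin N × Fin N, h (runSteps f σ₀ m (induced θ c))) -
      𝔼 e, h (runSteps f σ₀ m e)| ≤
    l * (m * (2 ^ k * (2 * (12 * ((s : ℝ) + 1)) ^ 2) / (N : ℝ) ^ 2)) + 3 / (2 * l) := by
  classical
  have hinfo : ∀ g : S → (Fin N → Fin k → ZMod 2) × (Fin N → Fin k → ZMod 2) → ℝ,
      (∀ σ θ, 0 ≤ g σ θ) → (∀ θ, ∑ σ, g σ θ = 1) →
      ∑ σ, info (fun θ (c : Fin N × Fin N) => θ.1 c.1 + θ.2 c.2) (g σ) ≤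
        2 ^ k * (2 * (12 * ((s : ℝ) + 1)) ^ 2) / (N : ℝ) ^ 2 :=
    fun g hg0 hg1 => sum_info_le s hS g hg0 hg1
  generalize 2 ^ k * (2 * (12 * ((s : ℝ) + 1)) ^ 2) / (N : ℝ) ^ 2 = ε at hinfo hε ⊢
  exact abs_process_sub_le _ ε hinfo f σ₀ h hh m hε l hl

/-- A streaming algorithm with little memory hardly distinguishes induced from uniform labels. -/
lemma abs_expect_run_sub_le [NeZero N] [NeZero m] (A : StreamingAlgorithm n) (ω : A.Ω) (τ l : ℝ)
    (hl : 0 < l)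
    (hε : m * (2 ^ k * (2 * (12 * ((A.space : ℝ) + 1)) ^ 2) / (N : ℝ) ^ 2) ≤ 1) :
    |(𝔼 θ, 𝔼 c : Fin m → Fin N × Fin N,
        if A.run ω (stream ι (induced θ c)) ≤ τ then (1 : ℝ) else 0) -
      𝔼 e, if A.run ω (stream ι e) ≤ τ then (1 : ℝ) else 0| ≤
    l * (m * (2 ^ k * (2 * (12 * ((A.space : ℝ) + 1)) ^ 2) / (N : ℝ) ^ 2)) + 3 / (2 * l) := by
  -- Processes are indexed by all of `ℕ`, so the block index is reduced modulo `m`; only indices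
  -- below `m` occur in the run.
  let B : ℕ → LabelledEdge N k → List (Sym2 (Fin n)) := fun j c => block ι (Fin.ofNat m j) c
  let f : ℕ → (Fin A.space → Bool) → LabelledEdge N k → (Fin A.space → Bool) := fun j σ c =>
    ((B j c).zipIdx (j * (2 ^ k * 2))).foldl (fun s p => A.update ω p.2 p.1 s) σ
  let h : (Fin A.space → Bool) → ℝ := fun σ => if A.output ω σ ≤ τ then 1 else 0
  have hrun : ∀ e : Fin m → LabelledEdge N k,
      A.run ω (stream ι e) = A.output ω (runSteps f (A.init ω) m e) := by
    intro e
    have hs : stream ι e = (List.ofFn fun i : Fin m => B i (e i)).flatten := by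
      simp [stream, B]
    rw [StreamingAlgorithm.run, hs, foldl_flatten_ofFn _ (2 ^ k * 2) _ B
      fun j c => length_block ι _ c]
  have hh : ∀ σ, 0 ≤ h σ ∧ h σ ≤ 1 := fun σ => by simp only [h]; split_ifs <;> norm_num
  have hrun' : ∀ e : Fin m → LabelledEdge N k, (if A.run ω (stream ι e) ≤ τ then (1 : ℝ) else 0) =
      h (runSteps f (A.init ω) m e) := fun e => by rw [hrun e]
  simp only [hrun']
  exact abs_expect_runSteps_induced_sub_le A.space (by simp) f (A.init ω) h hh l hl hε

end Lift

/-! ### Measurability and the lower bound for fixed parameters -/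

namespace StreamingAlgorithm

variable {n : ℕ}

/-- The memory has finitely many states, so the event can be split according to the state before
each update and before the output. -/
lemma measurableSet_run_le (A : StreamingAlgorithm n) (σ : List (Sym2 (Fin n))) (τ : ℝ) :
    MeasurableSet {ω | A.run ω σ ≤ τ} := by
  have hset : ∀ (S : A.Ω → (Fin A.space → Bool)) (hS : Measurable S) (s),
      MeasurableSet {ω | S ω = s} := fun S hS s => hS (measurableSet_singleton s)
  have hfold : ∀ (l : List (Sym2 (Fin n) × ℕ)) (S : A.Ω → (Fin A.space → Bool)), Measurable S →
      Measurable fun ω => l.foldl (fun s p => A.update ω p.2 p.1 s) (S ω) := by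
    intro l
    induction l with
    | nil => exact fun S hS => hS
    | cons p l ih =>
      intro S hS
      refine ih _ (measurable_to_countable' fun s' => ?_)
      have : (fun ω => A.update ω p.2 p.1 (S ω)) ⁻¹' {s'} =
          ⋃ s, {ω | S ω = s} ∩ {ω | A.update ω p.2 p.1 s = s'} := by
        ext ω; simp
      rw [this]
      exact MeasurableSet.iUnion fun s =>
        (hset S hS s).inter (hset _ (A.measurable_update p.2 p.1 s) s')
  have hS := hfold σ.zipIdx A.init A.measurable_init
  have : {ω | A.run ω σ ≤ τ} = ⋃ s,
      {ω | σ.zipIdx.foldl (fun s p => A.update ω p.2 p.1 s) (A.init ω) = s} ∩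
        {ω | A.output ω s ≤ τ} := by
    ext ω; simp [run]
  rw [this]
  exact MeasurableSet.iUnion fun s =>
    (hset _ hS s).inter (measurableSet_le (A.measurable_output s) measurable_const)

lemma Estimates.mono {A : StreamingAlgorithm n} {α β p : ℝ} (h : A.Estimates α p) (hαβ : α ≤ β) :
    A.Estimates β p := fun G σ hσ =>
  (h G σ hσ).trans (MeasureTheory.measureReal_mono fun _ hω =>
    ⟨hω.1, hω.2.trans (mul_le_mul_of_nonneg_right hαβ (opt_nonneg G))⟩)

end StreamingAlgorithm

lemma integral_expect {Ω I : Type} [MeasurableSpace Ω] (μ : MeasureTheory.Measure Ω) [Fintype I]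
    (f : I → Ω → ℝ) (hf : ∀ i, MeasureTheory.Integrable (f i) μ) :
    ∫ ω, 𝔼 i, f i ω ∂μ = 𝔼 i, ∫ ω, f i ω ∂μ := by
  simp only [Fintype.expect_eq_sum_div_card]
  rw [MeasureTheory.integral_div, MeasureTheory.integral_finsetSum _ fun i _ => hf i]

lemma integrable_expect {Ω I : Type} [MeasurableSpace Ω] (μ : MeasureTheory.Measure Ω) [Fintype I]
    (f : I → Ω → ℝ) (hf : ∀ i, MeasureTheory.Integrable (f i) μ) :
    MeasureTheory.Integrable (fun ω => 𝔼 i, f i ω) μ := by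
  simp only [Fintype.expect_eq_sum_div_card]
  exact (MeasureTheory.integrable_finsetSum _ fun i _ => hf i).div_const _

/-- The lower bound for fixed parameters: `N` is the number of vertices on each side of the base
graph, `m` its number of edges, `2 ^ k` the number of sheets of the lift. -/
theorem not_estimates {n N m k K : ℕ} [NeZero n] [NeZero N] [NeZero m] (hK : 1 ≤ K)
    (A : StreamingAlgorithm n) (α p η l : ℝ) (hα : 0 ≤ α) (hl : 0 < l)
    (hcard : (2 * N + m) * 2 ^ k ≤ n)
    (hgap : α * (m * (2 ^ k * 2) * (2 * N + m)) < K * (N * 2 ^ k))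
    (hmeet : (𝔼 e : Fin m → LabelledEdge N k, meetings e) * (2 * K) ≤ η * (N * 2 ^ k))
    (hε : m * (2 ^ k * (2 * (12 * ((A.space : ℝ) + 1)) ^ 2) / (N : ℝ) ^ 2) ≤ 1)
    (hp : η + (l * (m * (2 ^ k * (2 * (12 * ((A.space : ℝ) + 1)) ^ 2) / (N : ℝ) ^ 2)) +
      3 / (2 * l)) < 2 * p - 1) :
    ¬ A.Estimates α p := by
  intro hA
  obtain ⟨ι⟩ : Nonempty (LiftVertex N m k ↪ Fin n) := by
    refine Function.Embedding.nonempty_of_card_le ?_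
    simp only [Fintype.card_sum, Fintype.card_prod, Fintype.card_fin, Fintype.card_pi, ZMod.card,
      Finset.prod_const, card_univ]
    linarith
  -- A correct output is at most `τ` for induced labels and exceeds `τ` on every good uniform lift,
  -- by `hgap`.
  set τ := α * (m * (2 ^ k * 2) * (2 * N + m)) with hτ
  let φ : (Fin m → LabelledEdge N k) → A.Ω → ℝ := fun e ω =>
    if A.run ω (stream ι e) ≤ τ then 1 else 0
  let F : (Fin m → LabelledEdge N k) → ℝ := fun e => A.μ.real {ω | A.run ω (stream ι e) ≤ τ}
  have hφ : ∀ e, φ e = Set.indicator {ω | A.run ω (stream ι e) ≤ τ} 1 := fun e => by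
    funext ω; simp [φ, Set.indicator_apply]
  have hint : ∀ e, MeasureTheory.Integrable (φ e) A.μ := fun e => by
    rw [hφ]
    exact (MeasureTheory.integrable_const (1 : ℝ)).indicator (A.measurableSet_run_le _ τ)
  have hF : ∀ e, ∫ ω, φ e ω ∂A.μ = F e := fun e => by
    rw [hφ, MeasureTheory.integral_indicator_one (A.measurableSet_run_le _ τ)]
  have hF1 : ∀ e, F e ≤ 1 := fun e => MeasureTheory.measureReal_le_one
  have hind : ∀ θ (c : Fin m → Fin N × Fin N), p ≤ F (induced θ c) := by
    intro θ c
    refine (hA _ _ (isStreamOf_liftGraph ι (induced θ c))).trans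
      (MeasureTheory.measureReal_mono fun ω hω => hω.2.trans ?_)
    exact mul_le_mul_of_nonneg_left (opt_liftGraph_induced_le ι θ c) hα
  have hp1 : p ≤ 1 := (hind 0 0).trans (hF1 _)
  have hK0 : (0 : ℝ) < K := by exact_mod_cast hK
  have hN0 : (0 : ℝ) < N := by exact_mod_cast NeZero.pos N
  -- Markov's inequality in pointwise form: on a bad lift the last summand is at least `1`, and `p ≤
  -- 1` makes the bound trivial.
  have hunif : ∀ e, F e ≤ 1 - p + meetings e * (2 * K) / (N * 2 ^ k) := by
    intro e
    have hme := meetings_nonneg e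
    by_cases hgood : 2 * K * meetings e ≤ N * 2 ^ k
    · have h1 := hA _ _ (isStreamOf_liftGraph ι e)
      have h2 := le_opt_liftGraph ι e K hK hgood
      have h3 : p ≤ A.μ.real {ω | A.run ω (stream ι e) ≤ τ}ᶜ := by
        refine h1.trans (MeasureTheory.measureReal_mono fun ω hω => ?_)
        simp only [Set.mem_compl_iff, Set.mem_ofPred_eq, not_le]
        exact hgap.trans_le (h2.trans hω.1)
      rw [MeasureTheory.probReal_compl_eq_one_sub (A.measurableSet_run_le _ τ)] at h3
      have h4 : 0 ≤ meetings e * (2 * K) / (N * 2 ^ k) := by positivity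
      change p ≤ 1 - F e at h3
      linarith
    · have h4 : 1 ≤ meetings e * (2 * K) / (N * 2 ^ k) := by
        rw [le_div_iff₀ (by positivity)]
        linarith
      linarith [hF1 e]
  have hunif' : 𝔼 e, F e ≤ 1 - p + η := by
    refine (Finset.expect_le_expect fun e _ => hunif e).trans ?_
    rw [Finset.expect_add_distrib, Fintype.expect_const, ← Finset.expect_div,
      ← Finset.expect_mul]
    gcongr
    rwa [div_le_iff₀ (by positivity)]
  have hind' : p ≤ 𝔼 θ : (Fin N → Fin k → ZMod 2) × (Fin N → Fin k → ZMod 2),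
      𝔼 c : Fin m → Fin N × Fin N, F (induced θ c) := by
    refine le_trans (le_of_eq ?_) (Finset.expect_le_expect fun θ _ =>
      Finset.expect_le_expect fun c _ => hind θ c)
    simp only [Fintype.expect_const]
  set κ := l * (m * (2 ^ k * (2 * (12 * ((A.space : ℝ) + 1)) ^ 2) / (N : ℝ) ^ 2)) +
    3 / (2 * l) with hκ
  have hdiff : ∀ ω, (𝔼 θ, 𝔼 c : Fin m → Fin N × Fin N, φ (induced θ c) ω) ≤
      (𝔼 e, φ e ω) + κ := fun ω => by
    have := (abs_le.1 (abs_expect_run_sub_le ι A ω τ l hl hε)).2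
    linarith
  have hi1 : MeasureTheory.Integrable (fun ω => 𝔼 θ, 𝔼 c : Fin m → Fin N × Fin N,
      φ (induced θ c) ω) A.μ :=
    integrable_expect _ _ fun θ => integrable_expect _ _ fun c => hint _
  have hi2 : MeasureTheory.Integrable (fun ω => 𝔼 e, φ e ω) A.μ :=
    integrable_expect _ _ fun e => hint e
  have hfin := MeasureTheory.integral_mono hi1
    (hi2.add (MeasureTheory.integrable_const κ)) hdiff
  simp only [Pi.add_apply] at hfin
  rw [MeasureTheory.integral_add hi2 (MeasureTheory.integrable_const κ),
    integral_expect _ _ fun θ => integrable_expect _ _ fun c => hint _,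
    integral_expect _ _ fun e => hint e] at hfin
  simp only [integral_expect A.μ _ fun c => hint _, hF, MeasureTheory.integral_const,
    MeasureTheory.probReal_univ, one_smul] at hfin
  linarith

/-! ### Asymptotic estimates and the choice of parameters -/

lemma eventually_mul_log_pow_le (D : ℝ) (j : ℕ) {r : ℝ} (hr : 0 < r) :
    ∀ᶠ n : ℕ in Filter.atTop, D * Real.log n ^ j ≤ (n : ℝ) ^ r := by
  have h := (isLittleO_log_rpow_rpow_atTop (j : ℝ) hr).comp_tendsto tendsto_natCast_atTop_atTop
  have h2 := h.bound (c := 1 / (|D| + 1)) (by positivity)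
  filter_upwards [h2, Filter.eventually_ge_atTop 1] with n hn hn1
  simp only [Function.comp_apply, Real.rpow_natCast] at hn
  rw [Real.norm_of_nonneg (pow_nonneg (Real.log_natCast_nonneg n) j),
    Real.norm_of_nonneg (by positivity)] at hn
  have hlog : 0 ≤ Real.log n ^ j := pow_nonneg (Real.log_natCast_nonneg n) j
  rw [one_div, ← div_eq_inv_mul, le_div_iff₀ (by positivity)] at hn
  nlinarith [le_abs_self D]

lemma one_sub_pow_le {N L n : ℕ} (hN : 1 ≤ N) (hn : 1 ≤ n) (hL : Real.log n ≤ L) :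
    (1 - 1 / (2 * (N : ℝ))) ^ (2 * N * L) ≤ 1 / n := by
  have hN' : (1 : ℝ) ≤ N := by exact_mod_cast hN
  have hn' : (0 : ℝ) < n := by exact_mod_cast hn
  have h0 : 0 ≤ 1 - 1 / (2 * (N : ℝ)) := by
    rw [sub_nonneg, div_le_one (by positivity)]; linarith
  calc (1 - 1 / (2 * (N : ℝ))) ^ (2 * N * L)
      ≤ Real.exp (-(1 / (2 * (N : ℝ)))) ^ (2 * N * L) := by
        refine pow_le_pow_left₀ h0 ?_ _
        linarith [Real.add_one_le_exp (-(1 / (2 * (N : ℝ))))]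
    _ = Real.exp (-L) := by
        rw [← Real.exp_nat_mul]
        congr 1
        push_cast
        field_simp
    _ ≤ Real.exp (-Real.log n) := Real.exp_le_exp.2 (by linarith)
    _ = 1 / n := by rw [Real.exp_neg, Real.exp_log hn', one_div]

end HC

end

theorem theorem5p1 (δ : ℝ) (hδ : 0 < δ) (p : ℝ) (hp : 1 / 2 < p)
    (A : ∀ n : ℕ, HC.StreamingAlgorithm n) (c : ℕ)
    (hA : (fun n : ℕ => ((A n).space : ℝ)) =O[Filter.atTop] fun n : ℕ => Real.log n ^ c) :
    ∀ᶠ n : ℕ in Filter.atTop, ¬ (A n).Estimates ((n : ℝ) ^ (1 / 2 - δ)) p := by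
  -- Decreasing `δ` only enlarges the ratio, hence the claim for `d` is stronger; `d ≤ 1 / 4` keeps
  -- the exponents below positive.
  obtain ⟨d, hd0, hd4, hdδ⟩ : ∃ d : ℝ, 0 < d ∧ d ≤ 1 / 4 ∧ d ≤ δ :=
    ⟨min δ (1 / 4), by positivity, min_le_right _ _, min_le_left _ _⟩
  obtain ⟨η, hη0, hη1, hηp⟩ : ∃ η : ℝ, 0 < η ∧ η ≤ 1 ∧ 4 * η ≤ 2 * p - 1 :=
    ⟨min 1 ((2 * p - 1) / 4), lt_min one_pos (by linarith), min_le_left _ _, by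
      linarith [min_le_right 1 ((2 * p - 1) / 4)]⟩
  obtain ⟨C, hC0, hC⟩ := hA.exists_pos
  have hlog : ∀ᶠ n : ℕ in Filter.atTop, (1 : ℝ) ≤ Real.log n :=
    (Real.tendsto_log_atTop.comp tendsto_natCast_atTop_atTop).eventually_ge_atTop 1
  filter_upwards [hC.bound, hlog, Filter.eventually_ge_atTop 1,
    HC.eventually_mul_log_pow_le 6 1 (by positivity : 0 < d / 4),
    HC.eventually_mul_log_pow_le (256 * 7 / η) 2 (by positivity : 0 < d / 2),
    HC.eventually_mul_log_pow_le (1152 * 2 * (C + 1) ^ 2 / η ^ 2) (2 * c + 1)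
      (by positivity : 0 < d / 2)] with n hs hy hn1 h1 h2 h3 hest
  have hn : (1 : ℝ) ≤ n := by exact_mod_cast hn1
  have hn0 : (0 : ℝ) < n := by linarith
  replace hest := hest.mono (Real.rpow_le_rpow_of_exponent_le hn
    (by linarith : 1 / 2 - δ ≤ 1 / 2 - d))
  revert hest
  set y := Real.log n with hydef
  set L := ⌈y⌉₊ with hL
  have hyL : y ≤ L := Nat.le_ceil y
  have hL1 : (1 : ℝ) ≤ L := hy.trans hyL
  have hLy : (L : ℝ) ≤ 2 * y := by
    have := Nat.ceil_lt_add_one (by linarith : 0 ≤ y)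
    linarith
  -- `x` is the target for the number `2 ^ k` of sheets, and `w` below the target for `N`. Their
  -- product leaves a factor `n ^ (d / 4)` for the logarithmic number of edges per vertex, `x` beats
  -- the ratio by `n ^ (d / 2)`, and `w` beats `x` by enough to absorb the squared memory.
  set x := (n : ℝ) ^ (1 / 2 - d / 2) with hx
  have hx1 : 1 ≤ x := Real.one_le_rpow hn (by linarith)
  obtain ⟨k, hk1, hk2⟩ : ∃ k : ℕ, (2 : ℝ) ^ k ≤ x ∧ x < 2 * 2 ^ k := by
    obtain ⟨k, hk⟩ := exists_nat_pow_near hx1 (one_lt_two)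
    exact ⟨k, hk.1, by rw [← pow_succ']; exact hk.2⟩
  set w := (n : ℝ) ^ (1 / 2 + d / 4) with hw
  have hw1 : 1 ≤ w := Real.one_le_rpow hn (by linarith)
  set N := ⌊w⌋₊ with hN
  have hN1 : 1 ≤ N := Nat.le_floor (by exact_mod_cast hw1)
  have hNw : (N : ℝ) ≤ w := Nat.floor_le (by linarith)
  have hN1' : (1 : ℝ) ≤ N := by exact_mod_cast hN1
  have hwN : w < 2 * N := by
    have := Nat.lt_floor_add_one w
    rw [← hN] at this
    linarith
  set q : ℝ := 2 ^ k with hq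
  have hq0 : 0 < q := by positivity
  have hq1 : 1 ≤ q := one_le_pow₀ (by norm_num)
  have hxw : x * w * (n : ℝ) ^ (d / 4) = n := by
    rw [hx, hw, ← Real.rpow_add hn0, ← Real.rpow_add hn0]
    conv_rhs => rw [← Real.rpow_one (n : ℝ)]
    congr 1; ring
  have hax : (n : ℝ) ^ (1 / 2 - d) * (n : ℝ) ^ (d / 2) = x := by
    rw [hx, ← Real.rpow_add hn0]; congr 1; ring
  have hxw2 : x * (n : ℝ) ^ (d / 2) ≤ w := by
    rw [hx, hw, ← Real.rpow_add hn0]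
    exact Real.rpow_le_rpow_of_exponent_le hn (by linarith)
  have hz : 1 ≤ (n : ℝ) ^ (d / 2) := Real.one_le_rpow hn (by linarith)
  set z := (n : ℝ) ^ (d / 2) with hzdef
  set α := (n : ℝ) ^ (1 / 2 - d) with hα
  have hα0 : 0 < α := Real.rpow_pos_of_pos hn0 _
  have hNq : (N : ℝ) * q ≤ n := by
    calc (N : ℝ) * q ≤ w * x := by gcongr
      _ ≤ x * w * (n : ℝ) ^ (d / 4) := by
        rw [mul_comm w x]
        exact le_mul_of_one_le_right (by positivity) (Real.one_le_rpow hn (by linarith))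
      _ = n := hxw
  have hηz : 256 * (L * (L + 1)) < η * z := by
    have e1 : 256 * 7 / η * y ^ 2 = 256 * (7 * y ^ 2) / η := by ring
    rw [e1, div_le_iff₀ hη0] at h2
    have h4 : (L : ℝ) * (L + 1) ≤ 2 * y * (3 * y) :=
      mul_le_mul hLy (by linarith) (by positivity) (by positivity)
    have h5 : 0 < y ^ 2 := by positivity
    linarith
  -- The expected value of `meetings` will be at most `4`, and Markov's inequality needs `4 * (2 *
  -- K) ≤ η * N * q`.
  set K := ⌊η * N * q / 8⌋₊ with hKdef
  have hηNq : 16 ≤ η * N * q := by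
    have h4 : z ≤ x * z := le_mul_of_one_le_left (by linarith) hx1
    have h5 : (N : ℝ) ≤ N * q := le_mul_of_one_le_right (by linarith) hq1
    have h6 : η * z ≤ η * (N * q * 4) := mul_le_mul_of_nonneg_left (by linarith) hη0.le
    have h7 : (1 : ℝ) * (1 + 1) ≤ L * (L + 1) :=
      mul_le_mul hL1 (by linarith) (by norm_num) (by linarith)
    linarith
  have hK : 1 ≤ K := Nat.le_floor (by push_cast; linarith)
  have hKle : (K : ℝ) ≤ η * N * q / 8 := Nat.floor_le (by positivity)
  have hKge : η * N * q / 16 ≤ K := by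
    have := Nat.lt_floor_add_one (η * N * q / 8)
    rw [← hKdef] at this
    linarith
  have : NeZero n := ⟨by omega⟩
  have : NeZero N := ⟨by omega⟩
  have hLN : 1 ≤ L := by exact_mod_cast hL1
  have : NeZero (2 * N * L) := ⟨by positivity⟩
  have hεle : ((2 * N * L : ℕ) : ℝ) *
      (2 ^ k * (2 * (12 * (((A n).space : ℝ) + 1)) ^ 2) / (N : ℝ) ^ 2) ≤ η ^ 2 := by
    have hyc : 1 ≤ y ^ c := one_le_pow₀ hy
    have hs' : ((A n).space : ℝ) + 1 ≤ (C + 1) * y ^ c := by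
      rw [Real.norm_of_nonneg (by positivity), Real.norm_of_nonneg (by positivity)] at hs
      linarith
    have hs2 : (((A n).space : ℝ) + 1) ^ 2 ≤ (C + 1) ^ 2 * y ^ (2 * c) := by
      calc _ ≤ ((C + 1) * y ^ c) ^ 2 := pow_le_pow_left₀ (by positivity) hs' 2
        _ = _ := by ring
    have h3' : 1152 * (2 * y) * ((C + 1) ^ 2 * y ^ (2 * c)) ≤ η ^ 2 * z := by
      have e1 : 1152 * 2 * (C + 1) ^ 2 / η ^ 2 * y ^ (2 * c + 1) =
        1152 * (2 * y) * ((C + 1) ^ 2 * y ^ (2 * c)) / η ^ 2 := by ring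
      rw [e1, div_le_iff₀ (by positivity)] at h3
      linarith
    have h4 : 1152 * L * (((A n).space : ℝ) + 1) ^ 2 ≤ η ^ 2 * z := by
      refine le_trans ?_ h3'
      gcongr
    have h5 : q * z ≤ 2 * N :=
      (mul_le_mul_of_nonneg_right hk1 (by linarith)).trans (hxw2.trans hwN.le)
    have h6 := mul_le_mul_of_nonneg_left h5 (by positivity : 0 ≤ η ^ 2)
    have h7 := mul_le_mul_of_nonneg_right h4 hq0.le
    have e2 : ((2 * N * L : ℕ) : ℝ) *
        (q * (2 * (12 * (((A n).space : ℝ) + 1)) ^ 2) / (N : ℝ) ^ 2) =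
        576 * L * (((A n).space : ℝ) + 1) ^ 2 * q / N := by
      push_cast; field_simp; ring
    rw [e2, div_le_iff₀ (by linarith)]
    linarith
  -- With `2 * N * L` edges the contraction term drops to `1 / n`. Since the accumulated information
  -- is at most `η ^ 2`, the weight `1 / η` balances the errors: together they are at most `η + η +
  -- 3 / 2 * η < 4 * η`.
  refine HC.not_estimates (N := N) (m := 2 * N * L) (k := k) hK (A n) α p η (1 / η) hα0.le
    (by positivity) ?_ ?_ ?_ (hεle.trans (pow_le_one₀ hη0.le hη1)) ?_
  · have : ((2 * N + 2 * N * L : ℕ) : ℝ) * 2 ^ k ≤ n := by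
      rw [← hxw, ← hq]
      push_cast
      have h1' : 2 * (1 + (L : ℝ)) ≤ (n : ℝ) ^ (d / 4) := by
        rw [pow_one] at h1; linarith
      calc (2 * (N : ℝ) + 2 * N * L) * q = q * N * (2 * (1 + L)) := by ring
        _ ≤ x * w * (n : ℝ) ^ (d / 4) := by gcongr
    exact_mod_cast this
  · push_cast
    rw [← hq]
    have h6 : 128 * α * (L * (L + 1)) < η * q := by
      have h7 := mul_lt_mul_of_pos_left hηz hα0
      have h8 := mul_lt_mul_of_pos_left hk2 hη0
      rw [← hax] at h8
      linarith
    calc α * (2 * N * L * (q * 2) * (2 * N + 2 * N * L))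
        = (128 * α * (L * (L + 1))) * (N ^ 2 * q / 16) := by ring
      _ < (η * q) * (N ^ 2 * q / 16) := by
        apply mul_lt_mul_of_pos_right h6; positivity
      _ = (η * N * q / 16) * (N * q) := by ring
      _ ≤ K * (N * q) := by gcongr
  · have hm := HC.expect_meetings_le (N := N) (G := Fin k → ZMod 2) (2 * N * L)
    have hcard : (Fintype.card (Fin k → ZMod 2) : ℝ) = q := by simp [ZMod.card, hq]
    rw [hcard] at hm
    have hpow := HC.one_sub_pow_le hN1 hn1 hyL
    have h7 : 1 / (n : ℝ) ≤ 1 / (N * q) := one_div_le_one_div_of_le (by positivity) hNq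
    have h8 : 2 * (N : ℝ) * q * ((1 - 1 / (2 * (N : ℝ))) ^ (2 * N * L) + 1 / (N * q)) ≤ 4 := by
      calc _ ≤ 2 * (N : ℝ) * q * (1 / (N * q) + 1 / (N * q)) := by gcongr; exact hpow.trans h7
        _ = 4 := by field_simp; norm_num
    have h9 := hm.trans h8
    calc _ ≤ 4 * (2 * (K : ℝ)) := by gcongr
      _ ≤ η * (N * q) := by linarith
  · have e3 : 3 / (2 * (1 / η)) = 3 / 2 * η := by field_simp
    rw [e3]
    have h10 := mul_le_mul_of_nonneg_left hεle (by positivity : 0 ≤ 1 / η)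
    have e4 : 1 / η * η ^ 2 = η := by field_simp
    rw [e4] at h10
    linarith
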